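/- Let $\Sigma$ be a finite alphabet, $\check\Sigma=\Sigma\cup\{\text{¢},\$\}$ with two new endmarkers, and for $x\in\Sigma^*$ of length $n$ let the input tape be circular with cells $0,\dots,n+1$ containing ¢$\,x\,\$$; write $x_{(k)}$ for the symbol in cell $k$. **1qfa verifiers.** A qfa verifier $V$ consists of a finite set $Q=Q_{non}\sqcup Q_{acc}\sqcup Q_{rej}$ of inner states with an initial state $q_0\in Q_{non}$, a finite communication alphabet $\Gamma$ with a blank $\#\in\Gamma$, and amplitudes $\delta:Q\times\check\Sigma\times\Gamma\times Q\times\Gamma\times\{0,\pm1\}\to\mathbb C$ such that, for every $x\in\Sigma^*$, the operator $U_\delta^x|q,k,\gamma\rangle=\sum_{q',\gamma',d}\delta(q,x_{(k)},\gamma,q',\gamma',d)\,|q',k+d \bmod (|x|+2),\gamma'\rangle$ is unitary. A prover $P$ has a finite tape alphabet $\Delta$ with a blank, an infinite private tape holding sequences over $\Delta$ with finitely many non-blank symbols, and for every input $x$ a sequence of unitary operators $U_{P,i}^x=S_{P,i}^x\otimes I$ $(i\ge1)$, where $S_{P,i}^x$ acts on the communication cell and on a finite initial segment of the private tape. On input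 $x$ the computation of $(P,V)$ starts in state $q_0$, head on ¢, with blank communication cell and blank private tape; $V$ and $P$ alternately apply $U^x_\delta$ and $U^x_{P,1},U^x_{P,2},\dots$, with $V$ first, and after each move of $V$ it is measured whether the inner state is in $Q_{acc}$ (accept), $Q_{rej}$ (reject) or $Q_{non}$ (continue). The acceptance (rejection) probability of $(P,V)$ on $x$ is the sum over all steps of the probabilities of accepting (rejecting) at that step. $V$ is a (measure-many) 1qfa verifier if $\delta(q,\sigma,\gamma,q',\gamma',d)=0$ whenever $d\ne1$ and, on every input $x$ and against every prover, all computation paths have halted after $|x|+2$ moves of $V$. **Classes.** $\mathrm{QIP}_{a,b}(1qfa)$ is the class of languages $L\subseteq\Sigma^*$ for which there are a 1qfa verifier $V$ and a prover $P$ such that $(P,V)$ accepts every $x\in L$ with probability at least $a$, and $(P^*,V)$ rejects every $x\notin L$ with probability at least $b$ for every prover $P^*$; $\mathrm{QIP}(1qfa)=\bigcup_{0<\epsilon\le 1/2}\mathrm{QIP}_{1/2+\epsilon,1/2+\epsilon}(1qfa)$. A (measure-many) 1qfa is defined in the same way without communication cell and prover, and $\mathrm{1QFA}$ is the class of languages $L$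 for which there are a 1qfa and an $\epsilon\in[0,1/2)$ such that every $x\in L$ is accepted, and every $x\in\Sigma^*\setminus L$ rejected, with probability at least $1-\epsilon$. $\mathrm{REG}$ is the class of regular languages. **Theorem.** For every finite alphabet $\Sigma$, the following hold for the classes of languages over $\Sigma$: $\mathrm{QIP}(1qfa)=\mathrm{REG}$, $\ \mathrm{REG}\subseteq\mathrm{QIP}_{1,1}(1qfa)$ (perfect completeness and soundness), and $\mathrm{1QFA}\subseteq\mathrm{QIP}(1qfa)$. The last inclusion is strict, $\mathrm{1QFA}\subsetneqq\mathrm{QIP}(1qfa)$, whenever $\Sigma$ has at least two letters; in particular $\mathrm{1QFA}\subsetneqq\mathrm{QIP}(1qfa)=\mathrm{REG}$ as classes of languages over all finite alphabets. -/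

import Mathlib

/-- The extended input alphabet: input letters together with the left and the right endmarker. -/
inductive TapeSymbol (α : Type*) : Type _
  | left : TapeSymbol α
  | letter : α → TapeSymbol α
  | right : TapeSymbol α

/-- The content of the input tape on input `x`: left endmarker, `x`, right endmarker. -/
def inputTape {α : Type*} (x : List α) : List (TapeSymbol α) :=
  TapeSymbol.left :: (x.map TapeSymbol.letter ++ [TapeSymbol.right])

theorem length_inputTape {α : Type*} (x : List α) : (inputTape x).length = x.length + 2 := by
  simp [inputTape]

/-- The symbol in cell `k` of the circular input tape, whose cells are `0, …, |x| + 1`. -/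
def scanned {α : Type*} (x : List α) (k : ZMod (x.length + 2)) : TapeSymbol α :=
  (inputTape x)[k.val]'(by rw [length_inputTape]; exact ZMod.val_lt k)

/-- Every inner state is exactly one of: non-halting, accepting, rejecting. -/
inductive StateKind : Type
  | non : StateKind
  | acc : StateKind
  | rej : StateKind
  deriving DecidableEq

/-! ### Quantum finite automata -/

/-- A (2-way, measure-many) quantum finite automaton. `δ q σ q' d` is the amplitude of going from
state `q`, scanning `σ`, to state `q'` while moving the head in direction `d ∈ {0, 1, -1}`. -/
structure Qfa (α : Type*) where
  Q : Type
  [fintypeQ : Fintype Q]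
  [decEqQ : DecidableEq Q]
  kind : Q → StateKind
  start : Q
  kind_start : kind start = StateKind.non
  δ : Q → TapeSymbol α → Q → SignType → ℂ

attribute [instance] Qfa.fintypeQ Qfa.decEqQ

namespace Qfa

variable {α : Type*} (M : Qfa α)

/-- The time-evolution operator on input `x`, as a matrix in the basis of configurations
(entry: row = new configuration, column = old configuration). -/
def evolution (x : List α) :
    Matrix (M.Q × ZMod (x.length + 2)) (M.Q × ZMod (x.length + 2)) ℂ :=
  fun c' c => ∑ d : SignType,
    if c'.2 = c.2 + (d : ZMod (x.length + 2)) then M.δ c.1 (scanned x c.2) c'.1 d else 0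

/-- The operator is unitary on every input. -/
def WellFormed : Prop :=
  ∀ x : List α, M.evolution x ∈ Matrix.unitaryGroup (M.Q × ZMod (x.length + 2)) ℂ

/-- The projection onto the configurations whose state is of kind `κ`. -/
def proj {n : ℕ} (κ : StateKind) (ψ : M.Q × ZMod (n + 2) → ℂ) : M.Q × ZMod (n + 2) → ℂ :=
  fun c => if M.kind c.1 = κ then ψ c else 0

/-- The (unnormalized) non-halting superposition after `t` steps on input `x`; a step is one
application of the evolution operator followed by a measurement. -/
def state (x : List α) : ℕ → (M.Q × ZMod (x.length + 2) → ℂ)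
  | 0 => Pi.single (M.start, 0) 1
  | t + 1 => M.proj StateKind.non ((M.evolution x).mulVec (state x t))

/-- The probability that step `t + 1` on input `x` yields the outcome `κ`. -/
noncomputable def probAt (κ : StateKind) (x : List α) (t : ℕ) : ℝ :=
  ∑ c, ‖M.proj κ ((M.evolution x).mulVec (M.state x t)) c‖ ^ 2

noncomputable def pAcc (x : List α) : ℝ := ∑' t, M.probAt StateKind.acc x t

noncomputable def pRej (x : List α) : ℝ := ∑' t, M.probAt StateKind.rej x t

/-- A 1-way qfa: the head always moves to the right, and on every input all computation paths have
halted when the head moves off the right endmarker, i.e. after `|x| + 2` steps. -/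
def IsOneWay : Prop :=
  (∀ q σ q' d, d ≠ 1 → M.δ q σ q' d = 0) ∧ ∀ x : List α, M.state x (x.length + 2) = 0

end Qfa

/-- The languages over `α` recognized by measure-many 1-way qfa's with bounded error. -/
def Class1QFA (α : Type*) : Set (Language α) :=
  {L | ∃ M : Qfa α, M.WellFormed ∧ M.IsOneWay ∧ ∃ ε : ℝ, 0 ≤ ε ∧ ε < 1 / 2 ∧
    (∀ x ∈ L, 1 - ε ≤ M.pAcc x) ∧ (∀ x ∉ L, 1 - ε ≤ M.pRej x)}

/-! ### Quantum interactive proof systems with qfa verifiers -/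

/-- A qfa verifier. `δ q σ γ q' γ' d` is the amplitude with which the verifier in state `q`,
scanning `σ` on the input tape and `γ` in the communication cell, changes to state `q'`, writes `γ'`
in the communication cell and moves the head in direction `d ∈ {0, 1, -1}`. -/
structure QfaVerifier (α : Type*) where
  Q : Type
  [fintypeQ : Fintype Q]
  [decEqQ : DecidableEq Q]
  Γ : Type
  [fintypeΓ : Fintype Γ]
  [decEqΓ : DecidableEq Γ]
  kind : Q → StateKind
  start : Q
  kind_start : kind start = StateKind.non
  /-- the blank communication symbol -/
  blank : Γ
  δ : Q → TapeSymbol α → Γ → Q → Γ → SignType → ℂ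

attribute [instance] QfaVerifier.fintypeQ QfaVerifier.decEqQ
  QfaVerifier.fintypeΓ QfaVerifier.decEqΓ

namespace QfaVerifier

variable {α : Type*} (V : QfaVerifier α)

/-- The verifier's visible configurations on inputs of length `n`: inner state, head position,
content of the communication cell. -/
abbrev Visible (n : ℕ) : Type := V.Q × ZMod (n + 2) × V.Γ

/-- The verifier's operator on input `x`, as a matrix in the basis of visible configurations
(entry: row = new configuration, column = old configuration). -/
def evolution (x : List α) : Matrix (V.Visible x.length) (V.Visible x.length) ℂ :=
  fun c' c => ∑ d : SignType,
    if c'.2.1 = c.2.1 + (d : ZMod (x.length + 2)) then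
      V.δ c.1 (scanned x c.2.1) c.2.2 c'.1 c'.2.2 d else 0

/-- The verifier's operator is unitary on every input. -/
def WellFormed : Prop :=
  ∀ x : List α, V.evolution x ∈ Matrix.unitaryGroup (V.Visible x.length) ℂ

end QfaVerifier

/-- Contents of the prover's private tape: infinite sequences over `Δ` with only finitely many
non-blank symbols. -/
def PrivateTape (Δ : Type) (blank : Δ) : Type :=
  {y : ℕ → Δ // {i | y i ≠ blank}.Finite}

namespace PrivateTape

variable {Δ : Type} {blank : Δ}

def allBlank : PrivateTape Δ blank := ⟨fun _ => blank, by simp⟩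

/-- The content of the first `k` cells. -/
def initial (k : ℕ) (y : PrivateTape Δ blank) : Fin k → Δ := fun i => y.1 i

/-- Replace the content of the first `k` cells by `u`. -/
def overwrite {k : ℕ} (u : Fin k → Δ) (y : PrivateTape Δ blank) : PrivateTape Δ blank :=
  ⟨fun i => if h : i < k then u ⟨i, h⟩ else y.1 i, by
    refine ((Set.finite_lt_nat k).union y.2).subset ?_
    intro i hi
    by_cases h : i < k
    · exact Or.inl h
    · exact Or.inr (by simpa [h] using hi)⟩

end PrivateTape

/-- A prover for communication alphabet `Γ`. On input `x`, his `(i + 1)`-st operation is `S ⊗ I`,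
where the unitary matrix `S = op x i` acts on the communication cell and the first `cells x i` cells
of his private tape, and `I` is the identity on the rest of the tape. -/
structure Prover (α : Type*) (Γ : Type) [Fintype Γ] [DecidableEq Γ] where
  Δ : Type
  [fintypeΔ : Fintype Δ]
  [decEqΔ : DecidableEq Δ]
  blank : Δ
  cells : List α → ℕ → ℕ
  op : (x : List α) → (i : ℕ) → Matrix.unitaryGroup (Γ × (Fin (cells x i) → Δ)) ℂ

attribute [instance] Prover.fintypeΔ Prover.decEqΔ

namespace QfaVerifier

variable {α : Type*} (V : QfaVerifier α) (P : Prover α V.Γ)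

/-- Global configurations: inner state, head position, communication cell, private tape. -/
abbrev Config (n : ℕ) : Type := V.Q × ZMod (n + 2) × V.Γ × PrivateTape P.Δ P.blank

/-- Superpositions of global configurations. Every superposition that occurs in a computation is a
finite one, because each operation of the prover acts on finitely many cells only; so it suffices
to work in the dense subspace of finite linear combinations of configurations. -/
abbrev Superposition (n : ℕ) : Type := V.Config P n →₀ ℂ

/-- The verifier's operation (tensored with the identity on the private tape). -/
noncomputable def verifierMove (x : List α) :
    V.Superposition P x.length →ₗ[ℂ] V.Superposition P x.length :=
  Finsupp.linearCombination ℂ fun (c : V.Config P x.length) =>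
    ∑ v' : V.Visible x.length,
      Finsupp.single (v'.1, v'.2.1, v'.2.2, c.2.2.2) (V.evolution x v' (c.1, c.2.1, c.2.2.1))

/-- The prover's `(i + 1)`-st operation (tensored with the identity on the verifier's inner state
and head position). -/
noncomputable def proverMove (x : List α) (i : ℕ) :
    V.Superposition P x.length →ₗ[ℂ] V.Superposition P x.length :=
  Finsupp.linearCombination ℂ fun (c : V.Config P x.length) =>
    ∑ w : V.Γ × (Fin (P.cells x i) → P.Δ),
      Finsupp.single (c.1, c.2.1, w.1, c.2.2.2.overwrite w.2)
        ((P.op x i).1 w (c.2.2.1, c.2.2.2.initial (P.cells x i)))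

/-- The projection onto the configurations whose inner state is of kind `κ`. -/
noncomputable def proj {n : ℕ} (κ : StateKind) :
    V.Superposition P n →ₗ[ℂ] V.Superposition P n :=
  Finsupp.linearCombination ℂ fun (c : V.Config P n) =>
    if V.kind c.1 = κ then Finsupp.single c 1 else 0

/-- The (unnormalized) superposition just before the verifier's `(t + 1)`-st move. The verifier
moves first, each of his moves is followed by a measurement, and the non-halting part is handed to
the prover. -/
noncomputable def state (x : List α) : ℕ → V.Superposition P x.length
  | 0 => Finsupp.single (V.start, 0, V.blank, PrivateTape.allBlank) 1
  | t + 1 => V.proverMove P x t (V.proj P StateKind.non (V.verifierMove P x (state x t)))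

/-- The part of kind `κ` of the superposition after the verifier's `(t + 1)`-st move. -/
noncomputable def outcome (κ : StateKind) (x : List α) (t : ℕ) : V.Superposition P x.length :=
  V.proj P κ (V.verifierMove P x (V.state P x t))

/-- The probability that the verifier's `(t + 1)`-st measurement yields the outcome `κ`. -/
noncomputable def probAt (κ : StateKind) (x : List α) (t : ℕ) : ℝ :=
  (V.outcome P κ x t).sum fun _ a => ‖a‖ ^ 2

/-- The overall acceptance probability of `(P, V)` on `x`. -/
noncomputable def pAcc (x : List α) : ℝ := ∑' t, V.probAt P StateKind.acc x t

/-- The overall rejection probability of `(P, V)` on `x`. -/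
noncomputable def pRej (x : List α) : ℝ := ∑' t, V.probAt P StateKind.rej x t

/-- A 1qfa verifier: the head always moves to the right, and on every input and against every
prover all computation paths have halted when the head moves off the right endmarker, i.e. after
`|x| + 2` moves of the verifier. -/
def IsOneWay : Prop :=
  (∀ q σ γ q' γ' d, d ≠ 1 → V.δ q σ γ q' γ' d = 0) ∧
    ∀ (P : Prover α V.Γ) (x : List α), V.outcome P StateKind.non x (x.length + 1) = 0

end QfaVerifier

/-- The languages over `α` recognized by `(a, b)`-QIP systems with 1qfa verifiers. -/
def QIPab1qfa (a b : ℝ) (α : Type*) : Set (Language α) :=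
  {L | ∃ V : QfaVerifier α, V.WellFormed ∧ V.IsOneWay ∧
    (∃ P : Prover α V.Γ, ∀ x ∈ L, a ≤ V.pAcc P x) ∧
    (∀ x ∉ L, ∀ P' : Prover α V.Γ, b ≤ V.pRej P' x)}

/-- The languages over `α` recognized by bounded-error QIP systems with 1qfa verifiers. -/
def QIP1qfa (α : Type*) : Set (Language α) :=
  ⋃ ε ∈ Set.Ioc (0 : ℝ) (1 / 2), QIPab1qfa (1 / 2 + ε) (1 / 2 + ε) α

/-- The regular languages over `α`. -/
def REG (α : Type*) : Set (Language α) := {L | L.IsRegular}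

/-! The head position of a one-way device is determined by time, so the computation can be followed
on inner states (with communication cell and private tape) alone. `MeasuredSystem` abstracts what
remains: unitary steps along the word `inputTape x`, each followed by a measurement and, with a
prover, by a further operation.

Upper bound (`isRegular_of_vecSystem`). Work in the Heisenberg picture: on a suffix, each strategy
of the prover yields an operator `M` with `0 ≤ M ≤ 1` whose quadratic form is the acceptance
probability from any given state. In finite dimension the unit ball is covered by finitely many
small balls. If the operator sets of two suffixes meet the same balls, the sets are mutually close;
prepending letters is nonexpansive, so the optimal acceptance probabilities differ by less than the
gap between completeness and soundness. Hence there are finitely many suffix classes, and the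
language is regular by Myhill-Nerode. With the identity as only strategy this covers 1qfa's.

A prover may use arbitrarily much private space, so finite dimension needs an argument (`SameGram`,
`exists_bounded_strategy`). The verifier sees the prover's side only through the Gram matrix of the
private vectors indexed by inner state and communication symbol. Such a matrix is realized in
dimension `|Q × Γ|`, and families with equal Gram matrices differ by a unitary; so every prover is
simulated within private space `Q × Γ`, and conversely such strategies are carried out by actual
provers.

Lower bound. A verifier simulates a DFA reversibly by handing the old state to the prover, insisting
on a blank cell in return. The prover cannot touch the inner state, so words outside the language
are accepted with probability `0`; an honest prover stores each message in a fresh cell and is never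
rejected.

Strictness. The words ending in `a` form a regular language. Minimizing the surviving weight of a
1qfa gives a limit superposition `ξ` of words ending in `a` on which further letters act without
halting, hence unitarily. By recurrence some positive powers of `b` bring `ξ` back arbitrarily close
to itself, so words ending in `a` and in `b` cannot be separated by a fixed gap. -/

/-! ### Measured systems -/

/-- A device that processes a word over `S`: it applies `step σ` for every letter `σ`, each time
followed by a measurement with the three outcomes of `StateKind`; `wt` is the weight (squared norm)
of an unnormalized state. -/
structure MeasuredSystem (S E : Type*) where
  step : S → E → E
  proj : StateKind → E → E
  wt : E → ℝ

namespace MeasuredSystem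

variable {S E : Type*} (D : MeasuredSystem S E)

/-- The state after reading a word, when `C i` is applied after the `i`-th measurement. -/
def run : List S → (ℕ → E → E) → E → E
  | [], _, φ => φ
  | σ :: u, C, φ => run u (fun i => C (i + 1)) (C 0 (D.proj StateKind.non (D.step σ φ)))

/-- The total probability of the outcome `κ` while reading a word. -/
def prob (κ : StateKind) : List S → (ℕ → E → E) → E → ℝ
  | [], _, _ => 0
  | σ :: u, C, φ => D.wt (D.proj κ (D.step σ φ)) +
      prob κ u (fun i => C (i + 1)) (C 0 (D.proj StateKind.non (D.step σ φ)))

/-- Steps and interspersed operations preserve the weight, and the measurement splits it. -/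
structure Conserves (D : MeasuredSystem S E) (C : ℕ → E → E) : Prop where
  step : ∀ σ φ, D.wt (D.step σ φ) = D.wt φ
  op : ∀ i φ, D.wt (C i φ) = D.wt φ
  split : ∀ φ, D.wt (D.proj StateKind.non φ) + D.wt (D.proj StateKind.acc φ) +
    D.wt (D.proj StateKind.rej φ) = D.wt φ

theorem Conserves.shift {D : MeasuredSystem S E} {C : ℕ → E → E} (h : D.Conserves C) :
    D.Conserves fun i => C (i + 1) :=
  ⟨h.step, fun i => h.op (i + 1), h.split⟩

/-- Each round moves weight from the surviving part into the two halting outcomes and loses none;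
the balance telescopes. -/
theorem Conserves.total {D : MeasuredSystem S E} {u : List S} {C : ℕ → E → E}
    (h : D.Conserves C) (φ : E) :
    D.prob StateKind.acc u C φ + D.prob StateKind.rej u C φ + D.wt (D.run u C φ) = D.wt φ := by
  induction u generalizing C φ with
  | nil => simp [prob, run]
  | cons σ u ih =>
    have h1 := ih h.shift (C 0 (D.proj StateKind.non (D.step σ φ)))
    have h2 := h.split (D.step σ φ)
    rw [h.op] at h1
    rw [h.step] at h2
    simp only [prob, run]
    linarith

theorem prob_nonneg (hwt : ∀ φ, 0 ≤ D.wt φ) (κ : StateKind) (u : List S) (C : ℕ → E → E) (φ : E) :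
    0 ≤ D.prob κ u C φ := by
  induction u generalizing C φ with
  | nil => exact le_rfl
  | cons σ u ih => exact add_nonneg (hwt _) (ih _ _)

theorem prob_append_id (κ : StateKind) (u v : List S) (φ : E) :
    D.prob κ (u ++ v) (fun _ => id) φ =
      D.prob κ u (fun _ => id) φ + D.prob κ v (fun _ => id) (D.run u (fun _ => id) φ) := by
  induction u generalizing φ with
  | nil => simp [prob, run]
  | cons σ u ih => simp [prob, run, ih, add_assoc]

theorem run_append_id (u v : List S) (φ : E) :
    D.run (u ++ v) (fun _ => id) φ = D.run v (fun _ => id) (D.run u (fun _ => id) φ) := by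
  induction u generalizing φ with
  | nil => simp [run]
  | cons σ u ih => simp [run, ih]

/-- A time-indexed computation `ψ` with outcome weights `p` that is simulated along `emb` by a run
of `D` on a word. -/
theorem sum_eq_prob {E' : Type*} (κ : StateKind) (u : List S) (C : ℕ → E → E) (φ : E)
    (ψ : ℕ → E') (p : ℕ → ℝ) (emb : ℕ → E → E') (h0 : ψ 0 = emb 0 φ)
    (hstep : ∀ t (ht : t < u.length) φ, ψ t = emb t φ →
      ψ (t + 1) = emb (t + 1) (C t (D.proj StateKind.non (D.step u[t] φ))) ∧
      p t = D.wt (D.proj κ (D.step u[t] φ))) :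
    ∑ t ∈ Finset.range u.length, p t = D.prob κ u C φ ∧ ψ u.length = emb u.length (D.run u C φ) := by
  induction u generalizing C φ ψ p emb with
  | nil => simpa [prob, run] using h0
  | cons σ u ih =>
    have h1 := hstep 0 (by simp) φ h0
    have h2 := ih (fun i => C (i + 1)) (C 0 (D.proj StateKind.non (D.step σ φ)))
      (fun t => ψ (t + 1)) (fun t => p (t + 1)) (fun t => emb (t + 1)) h1.1
      (fun t ht χ hχ => hstep (t + 1) (by simpa using ht) χ hχ)
    refine ⟨?_, h2.2⟩
    rw [List.length_cons, Finset.sum_range_succ', h2.1, h1.2, add_comm]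
    rfl

end MeasuredSystem

/-! ### Systems given by matrices -/

section VecSystem

open Matrix

variable {S X : Type*} [Fintype X]

/-- The measured system on `X → ℂ` with the matrices `B σ` as steps. -/
noncomputable def vecSystem (B : S → Matrix X X ℂ) (kind : X → StateKind) :
    MeasuredSystem S (X → ℂ) where
  step σ φ := B σ *ᵥ φ
  proj κ φ := fun c => if kind c = κ then φ c else 0
  wt φ := ∑ c, ‖φ c‖ ^ 2

theorem sum_norm_sq_eq_star_dotProduct (φ : X → ℂ) :
    ((∑ c, ‖φ c‖ ^ 2 : ℝ) : ℂ) = star φ ⬝ᵥ φ := by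
  simp only [dotProduct, Pi.star_apply, Complex.ofReal_sum, RCLike.star_def]
  refine Finset.sum_congr rfl fun c _ => ?_
  rw [Complex.conj_mul']
  simp

/-- The passage between evolving the state and evolving the observable. -/
theorem star_dotProduct_mulVec_conj (A M : Matrix X X ℂ) (φ : X → ℂ) :
    star φ ⬝ᵥ ((Aᴴ * M * A) *ᵥ φ) = star (A *ᵥ φ) ⬝ᵥ (M *ᵥ (A *ᵥ φ)) := by
  rw [star_mulVec, ← dotProduct_mulVec, mulVec_mulVec, mulVec_mulVec, Matrix.mul_assoc]

theorem sum_norm_sq_mulVec_unitary [DecidableEq X] {U : Matrix X X ℂ}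
    (hU : U ∈ Matrix.unitaryGroup X ℂ) (φ : X → ℂ) :
    ∑ c, ‖(U *ᵥ φ) c‖ ^ 2 = ∑ c, ‖φ c‖ ^ 2 := by
  have h := star_dotProduct_mulVec_conj U 1 φ
  rw [Matrix.mul_one, ← star_eq_conjTranspose, mem_unitaryGroup_iff'.1 hU, one_mulVec,
    one_mulVec, ← sum_norm_sq_eq_star_dotProduct, ← sum_norm_sq_eq_star_dotProduct] at h
  exact_mod_cast h.symm

theorem vecSystem_conserves [DecidableEq X] {B : S → Matrix X X ℂ} {kind : X → StateKind}
    {C : ℕ → Matrix X X ℂ} (hB : ∀ σ, B σ ∈ Matrix.unitaryGroup X ℂ)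
    (hC : ∀ i, C i ∈ Matrix.unitaryGroup X ℂ) :
    (vecSystem B kind).Conserves fun i φ => C i *ᵥ φ where
  step σ φ := sum_norm_sq_mulVec_unitary (hB σ) φ
  op i φ := sum_norm_sq_mulVec_unitary (hC i) φ
  split φ := by
    simp only [vecSystem, ← Finset.sum_add_distrib]
    refine Finset.sum_congr rfl fun c _ => ?_
    cases kind c <;> simp

end VecSystem

/-! ### Acceptance operators and regularity -/

section Heisenberg

open Matrix
open scoped MatrixOrder Matrix.Norms.L2Operator

variable {S X : Type*} [DecidableEq X]

/-- The matrix of the projection onto the outcome `κ`. -/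
def kindProj (kind : X → StateKind) (κ : StateKind) : Matrix X X ℂ :=
  diagonal fun c => if kind c = κ then 1 else 0

theorem conjTranspose_kindProj (kind : X → StateKind) (κ : StateKind) :
    (kindProj kind κ)ᴴ = kindProj kind κ := by
  rw [kindProj, diagonal_conjTranspose]
  congr 1
  ext c
  simp only [Pi.star_apply]
  split_ifs <;> simp

variable [Fintype X]

theorem kindProj_mul_self (kind : X → StateKind) (κ : StateKind) :
    kindProj kind κ * kindProj kind κ = kindProj kind κ := by
  simp [kindProj, diagonal_mul_diagonal]

theorem kindProj_mulVec (B : S → Matrix X X ℂ) (kind : X → StateKind) (κ : StateKind)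
    (φ : X → ℂ) : kindProj kind κ *ᵥ φ = (vecSystem B kind).proj κ φ := by
  ext c
  simp [kindProj, mulVec_diagonal, vecSystem]

theorem kindProj_nonneg (kind : X → StateKind) (κ : StateKind) : 0 ≤ kindProj kind κ := by
  rw [← kindProj_mul_self]
  nth_rw 1 [← conjTranspose_kindProj]
  exact star_mul_self_nonneg _

theorem kindProj_add_le_one (kind : X → StateKind) :
    kindProj kind StateKind.acc + kindProj kind StateKind.non ≤ 1 := by
  have h : (1 : Matrix X X ℂ) = kindProj kind StateKind.acc + kindProj kind StateKind.non +
      kindProj kind StateKind.rej := by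
    simp only [kindProj, diagonal_add, ← diagonal_one]
    congr 1
    ext c
    cases kind c <;> simp
  rw [h]
  exact le_add_of_nonneg_right (kindProj_nonneg _ _)

theorem norm_kindProj_le (kind : X → StateKind) (κ : StateKind) : ‖kindProj kind κ‖ ≤ 1 := by
  rw [kindProj, l2_opNorm_diagonal, pi_norm_le_iff_of_nonneg zero_le_one]
  intro c
  split_ifs <;> simp

theorem norm_le_one_of_mem_unitaryGroup {U : Matrix X X ℂ} (hU : U ∈ Matrix.unitaryGroup X ℂ) :
    ‖U‖ ≤ 1 := by
  have h := l2_opNorm_conjTranspose_mul_self U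
  rw [← star_eq_conjTranspose, mem_unitaryGroup_iff'.1 hU] at h
  -- Only an inequality: for empty `X` this norm is `0`.
  have h1 : ‖(1 : Matrix X X ℂ)‖ ≤ 1 := by
    rw [← diagonal_one, l2_opNorm_diagonal, pi_norm_le_iff_of_nonneg zero_le_one]
    intro c
    simp
  nlinarith [norm_nonneg U]

/-- One step of the backward evolution of acceptance operators. -/
def backStep (B : S → Matrix X X ℂ) (kind : X → StateKind) (σ : S) (C M : Matrix X X ℂ) :
    Matrix X X ℂ :=
  (B σ)ᴴ * (kindProj kind StateKind.acc +
    (kindProj kind StateKind.non)ᴴ * (Cᴴ * M * C) * kindProj kind StateKind.non) * B σ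

/-- The operators whose quadratic forms are the acceptance probabilities on a given word, over all
choices of the interspersed operations in `𝒞`. -/
def acceptOps (B : S → Matrix X X ℂ) (kind : X → StateKind) (𝒞 : Set (Matrix X X ℂ)) :
    List S → Set (Matrix X X ℂ)
  | [] => {0}
  | σ :: u => Set.image2 (backStep B kind σ) 𝒞 (acceptOps B kind 𝒞 u)

variable {B : S → Matrix X X ℂ} {kind : X → StateKind} {𝒞 : Set (Matrix X X ℂ)}

theorem star_dotProduct_backStep_mulVec (σ : S) (C M : Matrix X X ℂ) (φ : X → ℂ) :
    star φ ⬝ᵥ (backStep B kind σ C M *ᵥ φ) =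
      ((vecSystem B kind).wt ((vecSystem B kind).proj StateKind.acc (B σ *ᵥ φ)) : ℂ) +
      star (C *ᵥ (vecSystem B kind).proj StateKind.non (B σ *ᵥ φ)) ⬝ᵥ
        (M *ᵥ (C *ᵥ (vecSystem B kind).proj StateKind.non (B σ *ᵥ φ))) := by
  rw [backStep, star_dotProduct_mulVec_conj, add_mulVec, dotProduct_add]
  congr 1
  · rw [← kindProj_mul_self]
    nth_rw 1 [← conjTranspose_kindProj]
    rw [← kindProj_mulVec B kind, ← Matrix.mul_one (kindProj kind StateKind.acc)ᴴ,
      star_dotProduct_mulVec_conj, one_mulVec, ← sum_norm_sq_eq_star_dotProduct]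
    rfl
  · rw [star_dotProduct_mulVec_conj, star_dotProduct_mulVec_conj, kindProj_mulVec B]

/-- The operator depends on the strategy but not on `φ`. This uniformity allows suffixes to be
compared independently of the prefix read before. -/
theorem exists_acceptOp (u : List S) (C : ℕ → Matrix X X ℂ) (hC : ∀ i, C i ∈ 𝒞) :
    ∃ M ∈ acceptOps B kind 𝒞 u, ∀ φ,
      ((vecSystem B kind).prob StateKind.acc u (fun i φ => C i *ᵥ φ) φ : ℂ) =
        star φ ⬝ᵥ (M *ᵥ φ) := by
  induction u generalizing C with
  | nil => exact ⟨0, rfl, fun φ => by simp [MeasuredSystem.prob]⟩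
  | cons σ u ih =>
    obtain ⟨M, hM, h⟩ := ih (fun i => C (i + 1)) fun i => hC (i + 1)
    refine ⟨backStep B kind σ (C 0) M, ⟨C 0, hC 0, M, hM, rfl⟩, fun φ => ?_⟩
    rw [star_dotProduct_backStep_mulVec, ← h, MeasuredSystem.prob, Complex.ofReal_add]
    rfl

theorem exists_strategy_of_acceptOp (h𝒞 : 𝒞.Nonempty) (u : List S) (M : Matrix X X ℂ)
    (hM : M ∈ acceptOps B kind 𝒞 u) :
    ∃ C : ℕ → Matrix X X ℂ, (∀ i, C i ∈ 𝒞) ∧ ∀ φ,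
      ((vecSystem B kind).prob StateKind.acc u (fun i φ => C i *ᵥ φ) φ : ℂ) =
        star φ ⬝ᵥ (M *ᵥ φ) := by
  induction u generalizing M with
  | nil =>
    obtain ⟨C, hC⟩ := h𝒞
    rw [acceptOps, Set.mem_singleton_iff] at hM
    exact ⟨fun _ => C, fun _ => hC, fun φ => by simp [MeasuredSystem.prob, hM]⟩
  | cons σ u ih =>
    obtain ⟨C₀, hC₀, N, hN, rfl⟩ := hM
    obtain ⟨C, hC, h⟩ := ih N hN
    -- The strategy for the tail, preceded by `C₀`.
    refine ⟨fun i => Nat.casesOn i C₀ C, fun i => by cases i <;> simp [hC₀, hC], fun φ => ?_⟩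
    rw [star_dotProduct_backStep_mulVec, ← h, MeasuredSystem.prob, Complex.ofReal_add]
    rfl

/-- Acceptance operators are effects: `0 ≤ M ≤ 1` survives a backward step, because conjugation by
unitaries preserves both bounds and the accepting and non-halting projections add up to at most `1`.
-/
theorem norm_acceptOp_le (hB : ∀ σ, B σ ∈ Matrix.unitaryGroup X ℂ)
    (h𝒞 : ∀ C ∈ 𝒞, C ∈ Matrix.unitaryGroup X ℂ) (u : List S) {M : Matrix X X ℂ}
    (hM : M ∈ acceptOps B kind 𝒞 u) : ‖M‖ ≤ 1 := by
  suffices h : 0 ≤ M ∧ M ≤ 1 from (CStarAlgebra.norm_le_one_iff_of_nonneg M h.1).2 h.2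
  induction u generalizing M with
  | nil =>
    rw [acceptOps, Set.mem_singleton_iff] at hM
    subst hM
    exact ⟨le_rfl, zero_le_one⟩
  | cons σ u ih =>
    obtain ⟨C, hC, N, hN, rfl⟩ := hM
    obtain ⟨h0, h1⟩ := ih hN
    have hCN : Cᴴ * N * C ≤ 1 := by
      have := star_left_conjugate_le_conjugate h1 C
      rwa [mul_one, mem_unitaryGroup_iff'.1 (h𝒞 C hC)] at this
    constructor
    · exact star_left_conjugate_nonneg (add_nonneg (kindProj_nonneg _ _)
        (star_left_conjugate_nonneg (star_left_conjugate_nonneg h0 _) _)) _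
    · have h2 : (kindProj kind StateKind.non)ᴴ * (Cᴴ * N * C) * kindProj kind StateKind.non ≤
          kindProj kind StateKind.non := by
        have := star_left_conjugate_le_conjugate hCN (kindProj kind StateKind.non)
        rw [mul_one, star_eq_conjTranspose, conjTranspose_kindProj, kindProj_mul_self] at this
        rwa [conjTranspose_kindProj]
      have h3 := star_left_conjugate_le_conjugate
        ((add_le_add_right h2 _).trans (kindProj_add_le_one kind)) (B σ)
      rwa [mul_one, mem_unitaryGroup_iff'.1 (hB σ)] at h3

/-- A backward step is affine in `M`: the accepting term cancels in the difference, and what is left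
is conjugation by contractions. -/
theorem norm_backStep_sub_le (hB : ∀ σ, B σ ∈ Matrix.unitaryGroup X ℂ) (σ : S)
    {C : Matrix X X ℂ} (hC : C ∈ Matrix.unitaryGroup X ℂ) (M N : Matrix X X ℂ) :
    ‖backStep B kind σ C M - backStep B kind σ C N‖ ≤ ‖M - N‖ := by
  have hconj : ∀ {T : Matrix X X ℂ} (_ : ‖T‖ ≤ 1) (K : Matrix X X ℂ), ‖Tᴴ * K * T‖ ≤ ‖K‖ := by
    intro T hT K
    calc ‖Tᴴ * K * T‖ ≤ ‖Tᴴ‖ * ‖K‖ * ‖T‖ :=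
          (l2_opNorm_mul _ _).trans
            (mul_le_mul_of_nonneg_right (l2_opNorm_mul _ _) (norm_nonneg _))
      _ ≤ 1 * ‖K‖ * 1 := by
          rw [l2_opNorm_conjTranspose]
          gcongr
      _ = ‖K‖ := by ring
  have h : backStep B kind σ C M - backStep B kind σ C N =
      (B σ)ᴴ * ((kindProj kind StateKind.non)ᴴ * (Cᴴ * (M - N) * C) *
        kindProj kind StateKind.non) * B σ := by
    simp only [backStep]
    noncomm_ring
  rw [h]
  exact (hconj (norm_le_one_of_mem_unitaryGroup (hB σ)) _).trans
    ((hconj (norm_kindProj_le _ _) _).trans (hconj (norm_le_one_of_mem_unitaryGroup hC) _))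

/-- The same operations are chosen along `v` in both cases, so nonexpansiveness carries the bound
through every prepended letter. -/
theorem acceptOps_append_close (hB : ∀ σ, B σ ∈ Matrix.unitaryGroup X ℂ)
    (h𝒞 : ∀ C ∈ 𝒞, C ∈ Matrix.unitaryGroup X ℂ) {u u' : List S} {r : ℝ}
    (h : ∀ M ∈ acceptOps B kind 𝒞 u, ∃ N ∈ acceptOps B kind 𝒞 u', ‖M - N‖ < r) (v : List S) :
    ∀ M ∈ acceptOps B kind 𝒞 (v ++ u), ∃ N ∈ acceptOps B kind 𝒞 (v ++ u'), ‖M - N‖ < r := by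
  induction v with
  | nil => exact h
  | cons σ v ih =>
    rintro _ ⟨C, hC, M, hM, rfl⟩
    obtain ⟨N, hN, hMN⟩ := ih M hM
    exact ⟨_, ⟨C, hC, N, hN, rfl⟩, (norm_backStep_sub_le hB σ (h𝒞 C hC) M N).trans_lt hMN⟩

theorem norm_star_dotProduct_mulVec_le (M : Matrix X X ℂ) (φ : X → ℂ) :
    ‖star φ ⬝ᵥ (M *ᵥ φ)‖ ≤ ‖M‖ * ∑ c, ‖φ c‖ ^ 2 := by
  have h1 := norm_inner_le_norm (𝕜 := ℂ) (WithLp.toLp 2 φ) (WithLp.toLp 2 (M *ᵥ φ))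
  rw [EuclideanSpace.inner_eq_star_dotProduct, dotProduct_comm] at h1
  have h2 := l2_opNorm_mulVec M (WithLp.toLp 2 φ)
  have h3 : ‖WithLp.toLp 2 φ‖ ^ 2 = ∑ c, ‖φ c‖ ^ 2 := EuclideanSpace.norm_sq_eq _
  calc ‖star φ ⬝ᵥ (M *ᵥ φ)‖ ≤ ‖WithLp.toLp 2 φ‖ * ‖WithLp.toLp 2 (M *ᵥ φ)‖ := h1
    _ ≤ ‖WithLp.toLp 2 φ‖ * (‖M‖ * ‖WithLp.toLp 2 φ‖) :=
        mul_le_mul_of_nonneg_left h2 (norm_nonneg _)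
    _ = ‖M‖ * ∑ c, ‖φ c‖ ^ 2 := by rw [← h3]; ring

/-- If finitely many classes of suffixes suffice to decide membership, then the language is
regular. -/
theorem Language.isRegular_of_suffix_classes {α β : Type*} [Finite β] {L : Language α}
    (c : List α → β) (hc : ∀ z z', c z = c z' → ∀ y, y ++ z ∈ L → y ++ z' ∈ L) :
    L.IsRegular := by
  -- Every left quotient is a union of classes of `c`, so there are only finitely many of them.
  refine Language.IsRegular.of_finite_range_leftQuotient
    ((Set.finite_range fun T : Set β => (c ⁻¹' T : Set (List α))).subset ?_)
  rintro _ ⟨y, rfl⟩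
  refine ⟨c '' {z | y ++ z ∈ L}, ?_⟩
  ext z'
  constructor
  · rintro ⟨z, hz, hzz'⟩
    exact hc z z' hzz' y hz
  · exact fun hz => ⟨z', hz, rfl⟩

/-- A language decided with bounded error by a finite-dimensional measured system with unitary
steps, where the operations after the measurements are chosen existentially from a set of
unitaries, is regular. -/
theorem isRegular_of_vecSystem {α : Type*} {B : TapeSymbol α → Matrix X X ℂ}
    (hB : ∀ σ, B σ ∈ Matrix.unitaryGroup X ℂ)
    (h𝒞 : ∀ C ∈ 𝒞, C ∈ Matrix.unitaryGroup X ℂ) (h𝒞' : 𝒞.Nonempty)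
    {φ : X → ℂ} (hφ : ∑ c, ‖φ c‖ ^ 2 = 1) {L : Language α} {lo hi : ℝ} (hlt : lo < hi)
    (hL : ∀ x ∈ L, ∃ C : ℕ → Matrix X X ℂ, (∀ i, C i ∈ 𝒞) ∧
      hi ≤ (vecSystem B kind).prob StateKind.acc (inputTape x) (fun i φ => C i *ᵥ φ) φ)
    (hL' : ∀ x ∉ L, ∀ C : ℕ → Matrix X X ℂ, (∀ i, C i ∈ 𝒞) →
      (vecSystem B kind).prob StateKind.acc (inputTape x) (fun i φ => C i *ᵥ φ) φ ≤ lo) :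
    L.IsRegular := by
  -- Two operators in a common ball of radius `r` are at distance less than `2 * r`, which is
  -- exactly the gap.
  obtain ⟨r, hr, hr2⟩ : ∃ r : ℝ, 0 < r ∧ 2 * r = hi - lo := ⟨(hi - lo) / 2, by linarith, by ring⟩
  obtain ⟨T, -, hT, hcover⟩ := finite_cover_balls_of_compact
    (isCompact_closedBall (0 : Matrix X X ℂ) 1) hr
  have := hT.to_subtype
  let tail : List α → List (TapeSymbol α) := fun z => z.map TapeSymbol.letter ++ [TapeSymbol.right]
  -- The class of a suffix records which of the finitely many balls its set of acceptance operators
  -- meets.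
  refine Language.isRegular_of_suffix_classes
    (fun z => {N : T | ∃ M ∈ acceptOps B kind 𝒞 (tail z), M ∈ Metric.ball N.1 r}) ?_
  intro z z' hzz' y hy
  by_contra hy'
  have hclose : ∀ M ∈ acceptOps B kind 𝒞 (tail z),
      ∃ N ∈ acceptOps B kind 𝒞 (tail z'), ‖M - N‖ < 2 * r := by
    intro M hM
    have hM1 := hcover (mem_closedBall_zero_iff.2 (norm_acceptOp_le hB h𝒞 _ hM))
    simp only [Set.mem_iUnion] at hM1
    obtain ⟨K, hK, hMK⟩ := hM1
    obtain ⟨N, hN, hNK⟩ := (Set.ext_iff.1 hzz' ⟨K, hK⟩).1 ⟨M, hM, hMK⟩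
    refine ⟨N, hN, ?_⟩
    rw [← dist_eq_norm]
    calc dist M N ≤ dist M K + dist N K := dist_triangle_right _ _ _
      _ < r + r := add_lt_add hMK hNK
      _ = 2 * r := by ring
  have happ : ∀ w : List α, inputTape (y ++ w) =
      (TapeSymbol.left :: y.map TapeSymbol.letter) ++ tail w := by
    intro w
    simp [inputTape, tail]
  obtain ⟨C, hC, hhi⟩ := hL _ hy
  obtain ⟨M, hM, hMC⟩ := exists_acceptOp (B := B) (kind := kind) (inputTape (y ++ z)) C hC
  rw [happ] at hM
  obtain ⟨N, hN, hMN⟩ := acceptOps_append_close hB h𝒞 hclose _ M hM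
  rw [← happ] at hN
  -- Turned back into a strategy, the nearby operator would accept `y ++ z'` with probability above
  -- `lo`.
  obtain ⟨C', hC', hNC⟩ := exists_strategy_of_acceptOp h𝒞' _ N hN
  have hlo := hL' _ hy' C' hC'
  have h := norm_star_dotProduct_mulVec_le (M - N) φ
  rw [sub_mulVec, dotProduct_sub, ← hMC, ← hNC, hφ, mul_one, ← Complex.ofReal_sub,
    Complex.norm_real, Real.norm_eq_abs] at h
  linarith [le_abs_self ((vecSystem B kind).prob StateKind.acc (inputTape (y ++ z))
    (fun i φ => C i *ᵥ φ) φ - (vecSystem B kind).prob StateKind.acc (inputTape (y ++ z'))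
    (fun i φ => C' i *ᵥ φ) φ)]

end Heisenberg

/-! ### One-way evolution -/

section ShiftMatrix

open Matrix

theorem submatrix_equiv_mem_unitaryGroup_iff {m n : Type*} [Fintype m] [DecidableEq m] [Fintype n]
    [DecidableEq n] (e : m ≃ n) (A : Matrix n n ℂ) :
    A.submatrix e e ∈ Matrix.unitaryGroup m ℂ ↔ A ∈ Matrix.unitaryGroup n ℂ := by
  rw [mem_unitaryGroup_iff', mem_unitaryGroup_iff', star_eq_conjTranspose, conjTranspose_submatrix,
    submatrix_mul_equiv, ← submatrix_one_equiv e, ← star_eq_conjTranspose]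
  refine ⟨fun h => ?_, fun h => by rw [h]⟩
  have := congrArg (fun M => M.submatrix e.symm e.symm) h
  simpa using this

variable {ι Z : Type*} [Fintype ι] [Fintype Z] [DecidableEq Z] [AddGroupWithOne Z]

/-- The matrix that applies `A k` at position `k` and then moves on to position `k + 1`. -/
def shiftMatrix (A : Z → Matrix ι ι ℂ) : Matrix (ι × Z) (ι × Z) ℂ :=
  fun c' c => if c'.2 = c.2 + 1 then A c.2 c'.1 c.1 else 0

/-- Translation by `1` is injective, so columns belonging to different positions have disjoint
supports; only the blocks `A k` contribute. -/
theorem star_shiftMatrix_mul_self (A : Z → Matrix ι ι ℂ) (c c' : ι × Z) :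
    (star (shiftMatrix A) * shiftMatrix A) c c' =
      if c.2 = c'.2 then (star (A c.2) * A c.2) c.1 c'.1 else 0 := by
  simp only [mul_apply, star_apply, shiftMatrix, Fintype.sum_prod_type]
  rcases eq_or_ne c.2 c'.2 with h | h
  · simp [h]
  · rw [if_neg h]
    refine Finset.sum_eq_zero fun q _ => Finset.sum_eq_zero fun k _ => ?_
    by_cases hk : k = c.2 + 1
    · have : k ≠ c'.2 + 1 := fun h' => h (add_right_cancel (hk.symm.trans h'))
      simp [this]
    · simp [hk]

theorem shiftMatrix_mem_unitaryGroup_iff [DecidableEq ι] (A : Z → Matrix ι ι ℂ) :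
    shiftMatrix A ∈ Matrix.unitaryGroup (ι × Z) ℂ ↔ ∀ k, A k ∈ Matrix.unitaryGroup ι ℂ := by
  simp only [mem_unitaryGroup_iff', ← ext_iff, star_shiftMatrix_mul_self, one_apply, Prod.forall,
    Prod.mk.injEq]
  constructor
  · intro h k q q'
    simpa using h q k q' k
  · intro h q k q' k'
    rcases eq_or_ne k k' with hk | hk
    · simp [h, hk]
    · simp [hk]

end ShiftMatrix

theorem scanned_natCast {α : Type*} (x : List α) {t : ℕ} (ht : t < (inputTape x).length) :
    scanned x (t : ZMod (x.length + 2)) = (inputTape x)[t] := by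
  have : (t : ZMod (x.length + 2)).val = t :=
    ZMod.val_natCast_of_lt (by rwa [length_inputTape] at ht)
  simp only [scanned, this]

/-- Lets unitarity of the global operator on all inputs be read off as unitarity of the matrix of
each single symbol. -/
theorem exists_scanned_eq {α : Type*} (σ : TapeSymbol α) :
    ∃ (x : List α) (k : ZMod (x.length + 2)), scanned x k = σ := by
  rcases σ with _ | a | _
  · exact ⟨[], ((0 : ℕ) : ZMod _), scanned_natCast [] (by simp [inputTape])⟩
  · exact ⟨[a], ((1 : ℕ) : ZMod _), scanned_natCast [a] (by simp [inputTape])⟩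
  · exact ⟨[], ((1 : ℕ) : ZMod _), scanned_natCast [] (by simp [inputTape])⟩

/-! ### One-way quantum finite automata -/

namespace Qfa

open Matrix

variable {α : Type*} {M : Qfa α}

/-- The amplitudes of a move to the right as matrices on the inner states. -/
def trans (M : Qfa α) (σ : TapeSymbol α) : Matrix M.Q M.Q ℂ := fun q' q => M.δ q σ q' 1

theorem evolution_eq_shiftMatrix (hM : M.IsOneWay) (x : List α) :
    M.evolution x = shiftMatrix fun k => M.trans (scanned x k) := by
  ext c' c
  rw [evolution, Finset.sum_eq_single (1 : SignType)]
  · simp only [shiftMatrix, trans, SignType.coe_one]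
    congr
  · intro d _ hd
    simp [hM.1 _ _ _ d hd]
  · simp

theorem trans_mem_unitaryGroup (hwf : M.WellFormed) (hM : M.IsOneWay) (σ : TapeSymbol α) :
    M.trans σ ∈ Matrix.unitaryGroup M.Q ℂ := by
  obtain ⟨x, k, rfl⟩ := exists_scanned_eq σ
  have h := hwf x
  rw [evolution_eq_shiftMatrix hM, shiftMatrix_mem_unitaryGroup_iff] at h
  exact h k

/-- The computation of a one-way automaton on inner states only. -/
noncomputable def localSystem (M : Qfa α) : MeasuredSystem (TapeSymbol α) (M.Q → ℂ) :=
  vecSystem M.trans M.kind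

/-- A superposition of inner states, with the head in cell `t`. -/
def atCell (M : Qfa α) (n t : ℕ) (φ : M.Q → ℂ) : M.Q × ZMod (n + 2) → ℂ :=
  fun c => if c.2 = (t : ZMod (n + 2)) then φ c.1 else 0

theorem evolution_mulVec_atCell (hM : M.IsOneWay) (x : List α) (t : ℕ) (φ : M.Q → ℂ) :
    M.evolution x *ᵥ M.atCell x.length t φ =
      M.atCell x.length (t + 1) (M.trans (scanned x t) *ᵥ φ) := by
  ext c
  rw [evolution_eq_shiftMatrix hM]
  simp only [mulVec, dotProduct, Fintype.sum_prod_type, shiftMatrix, atCell, mul_ite, mul_zero,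
    Finset.sum_ite_eq', Finset.mem_univ, if_true, Nat.cast_add, Nat.cast_one, ite_mul, zero_mul]
  split_ifs <;> simp

theorem proj_atCell (κ : StateKind) (n t : ℕ) (φ : M.Q → ℂ) :
    M.proj κ (M.atCell n t φ) = M.atCell n t (M.localSystem.proj κ φ) := by
  ext c
  simp only [proj, atCell, localSystem, vecSystem]
  split_ifs <;> rfl

theorem sum_norm_sq_atCell (n t : ℕ) (φ : M.Q → ℂ) :
    ∑ c, ‖M.atCell n t φ c‖ ^ 2 = M.localSystem.wt φ := by
  simp only [Fintype.sum_prod_type, atCell, localSystem, vecSystem]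
  refine Finset.sum_congr rfl fun q _ => ?_
  rw [Finset.sum_eq_single (t : ZMod (n + 2))]
  · simp
  · intro k _ hk
    simp [hk]
  · simp

/-- After `t` moves the head is in cell `t` with certainty, so `atCell` intertwines the local with
the global computation. -/
theorem sum_probAt_eq (hM : M.IsOneWay) (κ : StateKind) (x : List α) :
    ∑ t ∈ Finset.range (inputTape x).length, M.probAt κ x t =
        M.localSystem.prob κ (inputTape x) (fun _ => id) (Pi.single M.start 1) ∧
      M.state x (inputTape x).length = M.atCell x.length (inputTape x).length
        (M.localSystem.run (inputTape x) (fun _ => id) (Pi.single M.start 1)) := by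
  refine M.localSystem.sum_eq_prob κ (inputTape x) (fun _ => id) (Pi.single M.start 1) (M.state x)
    (M.probAt κ x) (M.atCell x.length) ?_ ?_
  · ext ⟨q, k⟩
    simp only [state, atCell, Pi.single_apply, Prod.mk.injEq, Nat.cast_zero]
    split_ifs <;> simp_all
  · intro t ht φ hφ
    have h : (M.evolution x) *ᵥ M.state x t =
        M.atCell x.length (t + 1) (M.localSystem.step (inputTape x)[t] φ) := by
      rw [hφ, evolution_mulVec_atCell hM, scanned_natCast x ht]
      rfl
    exact ⟨by rw [state, h, proj_atCell]; rfl, by rw [probAt, h, proj_atCell, sum_norm_sq_atCell]⟩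

theorem state_eq_zero (hM : M.IsOneWay) (x : List α) (t : ℕ) (ht : x.length + 2 ≤ t) :
    M.state x t = 0 := by
  induction t, ht using Nat.le_induction with
  | base => exact hM.2 x
  | succ t _ ih =>
    rw [state, ih, mulVec_zero]
    ext c
    simp [proj]

theorem tsum_probAt (hM : M.IsOneWay) (κ : StateKind) (x : List α) :
    ∑' t, M.probAt κ x t = M.localSystem.prob κ (inputTape x) (fun _ => id) (Pi.single M.start 1) := by
  rw [← (sum_probAt_eq hM κ x).1]
  refine tsum_eq_sum fun t ht => ?_
  rw [Finset.mem_range, not_lt, length_inputTape] at ht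
  simp [probAt, state_eq_zero hM x t ht, proj]

theorem wt_single_start : M.localSystem.wt (Pi.single M.start 1) = 1 := by
  simp only [localSystem, vecSystem]
  rw [Finset.sum_eq_single M.start]
  · simp
  · intro q _ hq
    simp [hq]
  · simp

theorem localSystem_conserves (hwf : M.WellFormed) (hM : M.IsOneWay) :
    M.localSystem.Conserves fun _ => id := by
  have h := vecSystem_conserves (kind := M.kind) (trans_mem_unitaryGroup hwf hM)
    (C := fun _ => 1) fun _ => one_mem _
  simp only [one_mulVec] at h
  exact h

theorem pAcc_add_pRej (hwf : M.WellFormed) (hM : M.IsOneWay) (x : List α) :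
    M.pAcc x + M.pRej x = 1 := by
  have h := (localSystem_conserves hwf hM).total (u := inputTape x) (Pi.single M.start 1)
  have h0 := (sum_probAt_eq hM StateKind.acc x).2
  rw [state_eq_zero hM x _ (length_inputTape x).ge] at h0
  have h1 := sum_norm_sq_atCell x.length (inputTape x).length
    (M.localSystem.run (inputTape x) (fun _ => id) (Pi.single M.start 1))
  rw [← h0] at h1
  rw [← h1, wt_single_start] at h
  rw [pAcc, pRej, tsum_probAt hM, tsum_probAt hM]
  simpa using h

end Qfa

theorem class1QFA_subset_REG (α : Type*) : Class1QFA α ⊆ REG α := by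
  rintro L ⟨M, hwf, hM, ε, hε0, hε, hL, hL'⟩
  have hone : (fun (_ : ℕ) (φ : M.Q → ℂ) => Matrix.mulVec 1 φ) = fun _ => id := by
    ext
    simp
  -- Without a prover the identity is the only operation between two steps.
  refine isRegular_of_vecSystem (𝒞 := {1}) (kind := M.kind) (lo := ε) (hi := 1 - ε)
    (Qfa.trans_mem_unitaryGroup hwf hM) ?_ ⟨1, rfl⟩ Qfa.wt_single_start (by linarith) ?_ ?_
  · rintro C rfl
    exact one_mem _
  · intro x hx
    refine ⟨fun _ => 1, fun _ => rfl, ?_⟩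
    rw [hone]
    exact (hL x hx).trans_eq (Qfa.tsum_probAt hM _ x)
  · intro x hx C hC
    obtain rfl : C = fun _ => 1 := funext hC
    rw [hone]
    have h1 := hL' x hx
    have h2 := Qfa.pAcc_add_pRej hwf hM x
    rw [Qfa.pAcc, Qfa.tsum_probAt hM] at h2
    exact le_of_add_le_add_right (h2.le.trans (by linarith) : _ ≤ ε + M.pRej x)

/-! ### A regular language beyond one-way quantum finite automata -/

section Recurrence

open Matrix Filter Topology

variable {X : Type*} [Fintype X]

theorem norm_le_one_of_sum_norm_sq_le {φ : X → ℂ} (h : ∑ c, ‖φ c‖ ^ 2 ≤ 1) : ‖φ‖ ≤ 1 := by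
  refine (pi_norm_le_iff_of_nonneg zero_le_one).2 fun c => ?_
  have h1 : ‖φ c‖ ^ 2 ≤ ∑ c, ‖φ c‖ ^ 2 :=
    Finset.single_le_sum (f := fun c => ‖φ c‖ ^ 2) (fun _ _ => by positivity) (Finset.mem_univ c)
  exact (sq_le_one_iff₀ (norm_nonneg _)).1 (h1.trans h)

theorem tendsto_of_sum_norm_sq_sub_tendsto {u : ℕ → X → ℂ} {ξ : X → ℂ}
    (h : Tendsto (fun k => ∑ c, ‖(u k - ξ) c‖ ^ 2) atTop (𝓝 0)) : Tendsto u atTop (𝓝 ξ) := by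
  refine tendsto_pi_nhds.2 fun c => ?_
  have h1 : Tendsto (fun k => ‖(u k - ξ) c‖ ^ 2) atTop (𝓝 0) :=
    squeeze_zero (fun _ => by positivity) (fun k => Finset.single_le_sum
      (f := fun c => ‖(u k - ξ) c‖ ^ 2) (fun _ _ => by positivity) (Finset.mem_univ c)) h
  have h2 := h1.sqrt
  simp only [Real.sqrt_sq (norm_nonneg _), Real.sqrt_zero] at h2
  exact tendsto_sub_nhds_zero_iff.1 (tendsto_zero_iff_norm_tendsto_zero.2 h2)

/-- Every vector is recurrent under a unitary matrix. -/
theorem exists_pow_mulVec_tendsto [DecidableEq X] {U : Matrix X X ℂ}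
    (hU : U ∈ Matrix.unitaryGroup X ℂ) {ξ : X → ℂ} (hξ : ∑ c, ‖ξ c‖ ^ 2 ≤ 1) :
    ∃ d : ℕ → ℕ, (∀ k, 0 < d k) ∧ Tendsto (fun k => (U ^ d k) *ᵥ ξ) atTop (𝓝 ξ) := by
  have hpow : ∀ k, U ^ k ∈ Matrix.unitaryGroup X ℂ := fun k => pow_mem hU k
  -- The orbit stays in a compact ball, so some subsequence converges. Its consecutive differences
  -- tend to `0`, and pulling them back by an isometry gives `U ^ d k *ᵥ ξ - ξ`, with `d k` the gap
  -- between consecutive indices.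
  obtain ⟨η, -, f, hf, hη⟩ := (isCompact_closedBall (0 : X → ℂ) 1).tendsto_subseq
    (x := fun k => (U ^ k) *ᵥ ξ) fun k => mem_closedBall_zero_iff.2
      (norm_le_one_of_sum_norm_sq_le (by rwa [sum_norm_sq_mulVec_unitary (hpow k)]))
  refine ⟨fun k => f (k + 1) - f k, fun k => Nat.sub_pos_of_lt (hf k.lt_succ_self),
    tendsto_of_sum_norm_sq_sub_tendsto ?_⟩
  have h1 := (hη.comp (tendsto_add_atTop_nat 1)).sub hη
  rw [sub_self] at h1
  have hcont : Continuous fun φ : X → ℂ => ∑ c, ‖φ c‖ ^ 2 := by fun_prop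
  have h2 := (hcont.tendsto 0).comp h1
  simp only [Pi.zero_apply, norm_zero, ne_eq, OfNat.ofNat_ne_zero, not_false_eq_true, zero_pow,
    Finset.sum_const_zero] at h2
  refine h2.congr fun k => ?_
  have h3 : (U ^ f (k + 1)) *ᵥ ξ - (U ^ f k) *ᵥ ξ =
      (U ^ f k) *ᵥ ((U ^ (f (k + 1) - f k)) *ᵥ ξ - ξ) := by
    rw [mulVec_sub, mulVec_mulVec, ← pow_add, Nat.add_sub_cancel' (hf k.lt_succ_self).le]
  simp only [Function.comp_apply, h3]
  exact sum_norm_sq_mulVec_unitary (hpow _) _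

/-- A projection decreases the weight coordinatewise, so equality of the sums forces equality in
every coordinate. -/
theorem vecSystem_proj_eq_of_wt_eq {S : Type*} (B : S → Matrix X X ℂ) (kind : X → StateKind)
    (κ : StateKind) {φ : X → ℂ}
    (h : (vecSystem B kind).wt ((vecSystem B kind).proj κ φ) = (vecSystem B kind).wt φ) :
    (vecSystem B kind).proj κ φ = φ := by
  have h1 := (Finset.sum_eq_sum_iff_of_le (s := Finset.univ)
    (f := fun c => ‖(vecSystem B kind).proj κ φ c‖ ^ 2) (g := fun c => ‖φ c‖ ^ 2) ?_).1 h
  · ext c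
    have h2 := h1 c (Finset.mem_univ c)
    simp only [vecSystem] at h2 ⊢
    split_ifs with hc
    · rfl
    · rw [if_neg hc] at h2
      simpa [eq_comm] using h2
  · intro c _
    simp only [vecSystem]
    split_ifs
    · exact le_rfl
    · simp

theorem continuous_vecSystem_run {S : Type*} (B : S → Matrix X X ℂ) (kind : X → StateKind)
    (u : List S) : Continuous ((vecSystem B kind).run u fun _ => id) := by
  induction u with
  | nil => exact continuous_id
  | cons σ u ih =>
    have h : Continuous fun φ => (vecSystem B kind).proj StateKind.non (B σ *ᵥ φ) := by
      refine continuous_pi fun c => ?_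
      simp only [vecSystem]
      split_ifs <;> fun_prop
    exact ih.comp h

theorem continuous_vecSystem_prob {S : Type*} (B : S → Matrix X X ℂ) (kind : X → StateKind)
    (κ : StateKind) (σ : S) : Continuous ((vecSystem B kind).prob κ [σ] fun _ => id) := by
  simp only [MeasuredSystem.prob, vecSystem, add_zero]
  refine continuous_finsetSum _ fun c _ => ?_
  split_ifs <;> fun_prop

end Recurrence

/-- The two-state automaton that remembers whether the last letter was `a`. -/
def lastLetterDFA {α : Type*} [DecidableEq α] (a : α) : DFA α Bool where
  step _ c := decide (c = a)
  start := false
  accept := {true}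

theorem append_mem_lastLetterDFA_accepts {α : Type*} [DecidableEq α] (a c : α) (w : List α) :
    w ++ [c] ∈ (lastLetterDFA a).accepts ↔ c = a := by
  rw [DFA.mem_accepts, DFA.eval_append_singleton]
  simp [lastLetterDFA]

/-! ### Non-halting limits of one-way quantum finite automata -/

namespace Qfa

open Matrix Filter Topology

variable {α : Type*} {M : Qfa α}

/-- The non-halting part of the superposition after reading the left endmarker and `w`. -/
noncomputable def after (M : Qfa α) (w : List α) : M.Q → ℂ :=
  M.localSystem.run (TapeSymbol.left :: w.map TapeSymbol.letter) (fun _ => id) (Pi.single M.start 1)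

theorem after_append (w v : List α) :
    M.after (w ++ v) = M.localSystem.run (v.map TapeSymbol.letter) (fun _ => id) (M.after w) := by
  rw [after, after, ← MeasuredSystem.run_append_id]
  simp

theorem localSystem_wt_nonneg (φ : M.Q → ℂ) : 0 ≤ M.localSystem.wt φ :=
  Finset.sum_nonneg fun _ _ => by positivity

theorem wt_run_le (hwf : M.WellFormed) (hM : M.IsOneWay) (u : List (TapeSymbol α)) (φ : M.Q → ℂ) :
    M.localSystem.wt (M.localSystem.run u (fun _ => id) φ) ≤ M.localSystem.wt φ := by
  have h := (localSystem_conserves hwf hM).total (u := u) φ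
  have h1 := M.localSystem.prob_nonneg localSystem_wt_nonneg StateKind.acc u (fun _ => id) φ
  have h2 := M.localSystem.prob_nonneg localSystem_wt_nonneg StateKind.rej u (fun _ => id) φ
  linarith

theorem pAcc_eq (hM : M.IsOneWay) (x : List α) :
    M.pAcc x = M.localSystem.prob StateKind.acc (TapeSymbol.left :: x.map TapeSymbol.letter)
        (fun _ => id) (Pi.single M.start 1) +
      M.localSystem.prob StateKind.acc [TapeSymbol.right] (fun _ => id) (M.after x) := by
  rw [pAcc, tsum_probAt hM, after, ← MeasuredSystem.prob_append_id]
  simp [inputTape]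

/-- Reading more letters can only increase the part of the acceptance probability that does not
come from the right endmarker. -/
theorem pAcc_sub_pAcc_append_le (hM : M.IsOneWay) (x v : List α) :
    M.pAcc x - M.pAcc (x ++ v) ≤
      M.localSystem.prob StateKind.acc [TapeSymbol.right] (fun _ => id) (M.after x) -
      M.localSystem.prob StateKind.acc [TapeSymbol.right] (fun _ => id)
        (M.localSystem.run (v.map TapeSymbol.letter) (fun _ => id) (M.after x)) := by
  rw [pAcc_eq hM, pAcc_eq hM, after_append, List.map_append, ← List.cons_append,
    MeasuredSystem.prob_append_id]
  have := M.localSystem.prob_nonneg localSystem_wt_nonneg StateKind.acc (v.map TapeSymbol.letter)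
    (fun _ => id) (M.after x)
  simp only [after] at this ⊢
  linarith

/-- There is a limit `ξ` of superpositions reached by words ending in `a` on which reading further
letters never halts. -/
theorem exists_nonhalting_limit (hwf : M.WellFormed) (hM : M.IsOneWay) (a : α) :
    ∃ (w : ℕ → List α) (ξ : M.Q → ℂ), Tendsto (fun n => M.after (w n ++ [a])) atTop (𝓝 ξ) ∧
      M.localSystem.wt ξ ≤ 1 ∧ ∀ v : List α,
        M.localSystem.wt (M.localSystem.run (v.map TapeSymbol.letter) (fun _ => id) ξ) =
          M.localSystem.wt ξ := by
  have hwt : Continuous M.localSystem.wt := by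
    simp only [localSystem, vecSystem]
    fun_prop
  -- Surviving weight only decreases along extensions. On extensions of nearly minimizing words it
  -- is squeezed to the infimum `μ`, so in the limit no letter can cause any loss.
  set μ := ⨅ w, M.localSystem.wt (M.after w) with hμ
  have hbdd : BddBelow (Set.range fun w => M.localSystem.wt (M.after w)) :=
    ⟨0, by rintro _ ⟨w, rfl⟩; exact localSystem_wt_nonneg _⟩
  have hex : ∀ n : ℕ, ∃ w, M.localSystem.wt (M.after w) < μ + 1 / ((n : ℝ) + 1) := fun n =>
    exists_lt_of_ciInf_lt (lt_add_of_pos_right _ (by positivity))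
  choose w hw using hex
  have hle1 : ∀ v, M.localSystem.wt (M.after v) ≤ 1 := fun v =>
    (wt_run_le hwf hM _ _).trans wt_single_start.le
  obtain ⟨ξ, -, f, hf, hξ⟩ := (isCompact_closedBall (0 : M.Q → ℂ) 1).tendsto_subseq
    (x := fun n => M.after (w n ++ [a])) fun n => mem_closedBall_zero_iff.2
      (norm_le_one_of_sum_norm_sq_le (hle1 _))
  have key : ∀ v : List α,
      M.localSystem.wt (M.localSystem.run (v.map TapeSymbol.letter) (fun _ => id) ξ) = μ := by
    intro v
    have h1 := ((hwt.comp (continuous_vecSystem_run M.trans M.kind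
      (v.map TapeSymbol.letter))).tendsto ξ).comp hξ
    refine tendsto_nhds_unique h1 ?_
    have h2 : Tendsto (fun n => μ + 1 / ((f n : ℝ) + 1)) atTop (𝓝 (μ + 0)) :=
      tendsto_const_nhds.add (tendsto_one_div_add_atTop_nhds_zero_nat.comp hf.tendsto_atTop)
    rw [add_zero] at h2
    refine tendsto_of_tendsto_of_tendsto_of_le_of_le tendsto_const_nhds h2 (fun n => ?_)
      fun n => ?_
    · have := ciInf_le hbdd (w (f n) ++ [a] ++ v)
      rw [after_append] at this
      exact this
    · refine le_trans ?_ (hw (f n)).le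
      have := wt_run_le hwf hM (([a] ++ v).map TapeSymbol.letter) (M.after (w (f n)))
      rwa [← after_append, ← List.append_assoc, after_append] at this
  have h0 : M.localSystem.wt ξ = μ := key []
  exact ⟨w ∘ f, ξ, hξ, h0.trans_le ((ciInf_le hbdd []).trans (hle1 [])),
    fun v => (key v).trans h0.symm⟩

/-- No weight is lost, so each measurement acts as the identity and only the unitary steps remain.
-/
theorem run_replicate_eq_pow (hwf : M.WellFormed) (hM : M.IsOneWay) (b : α) {ξ : M.Q → ℂ}
    (hξ : ∀ v : List α,
      M.localSystem.wt (M.localSystem.run (v.map TapeSymbol.letter) (fun _ => id) ξ) =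
        M.localSystem.wt ξ) (k : ℕ) :
    M.localSystem.run ((List.replicate k b).map TapeSymbol.letter) (fun _ => id) ξ =
      (M.trans (TapeSymbol.letter b) ^ k) *ᵥ ξ := by
  induction k with
  | zero => simp [MeasuredSystem.run]
  | succ k ih =>
    have h := hξ (List.replicate (k + 1) b)
    rw [List.replicate_succ', List.map_append, MeasuredSystem.run_append_id] at h ⊢
    rw [ih] at h ⊢
    rw [pow_succ', ← mulVec_mulVec]
    have h1 : M.localSystem.wt ξ = M.localSystem.wt (M.trans (TapeSymbol.letter b) *ᵥ
        (M.trans (TapeSymbol.letter b) ^ k) *ᵥ ξ) := by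
      rw [← hξ (List.replicate k b), ih]
      exact ((localSystem_conserves hwf hM).step _ _).symm
    exact vecSystem_proj_eq_of_wt_eq M.trans M.kind StateKind.non (h.trans h1)

end Qfa

/-- Appending a positive power of `b` leaves the language, so acceptance must drop by `1 - 2 * ε`.
The drop can only come from the right endmarker, whose contribution `F` is continuous, while
suitable powers of `b` return `ξ` to itself in the limit. -/
theorem lastLetterDFA_accepts_notMem_class1QFA {α : Type*} [DecidableEq α] {a b : α} (hab : b ≠ a) :
    (lastLetterDFA a).accepts ∉ Class1QFA α := by
  rintro ⟨M, hwf, hM, ε, -, hε, hL, hL'⟩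
  obtain ⟨w, ξ, hw, hξ1, hξ⟩ := Qfa.exists_nonhalting_limit hwf hM a
  obtain ⟨d, hd, hlim⟩ := exists_pow_mulVec_tendsto
    (Qfa.trans_mem_unitaryGroup hwf hM (TapeSymbol.letter b)) hξ1
  let F := M.localSystem.prob StateKind.acc [TapeSymbol.right] fun _ => id
  have hF : Continuous F := continuous_vecSystem_prob M.trans M.kind _ _
  have hgap : ∀ k, 1 - 2 * ε ≤ F ξ - F ((M.trans (TapeSymbol.letter b) ^ d k).mulVec ξ) := by
    intro k
    rw [← Qfa.run_replicate_eq_pow hwf hM b hξ]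
    have hT := continuous_vecSystem_run M.trans M.kind
      ((List.replicate (d k) b).map TapeSymbol.letter)
    refine ge_of_tendsto' (((hF.tendsto ξ).comp hw).sub (((hF.comp hT).tendsto ξ).comp hw))
      fun n => ?_
    refine le_trans ?_ (Qfa.pAcc_sub_pAcc_append_le hM (w n ++ [a]) (List.replicate (d k) b))
    have h1 := hL (w n ++ [a]) ((append_mem_lastLetterDFA_accepts a a _).2 rfl)
    obtain ⟨m, hm⟩ := Nat.exists_eq_add_one.2 (hd k)
    have h2 := hL' (w n ++ [a] ++ List.replicate (d k) b) (by
      rw [hm, List.replicate_succ', ← List.append_assoc, append_mem_lastLetterDFA_accepts]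
      exact hab)
    have h3 := Qfa.pAcc_add_pRej hwf hM (w n ++ [a] ++ List.replicate (d k) b)
    linarith
  -- By recurrence the right-hand side of `hgap` tends to `F ξ - F ξ = 0`, while its lower bound is
  -- a positive constant.
  have h0 := ge_of_tendsto' (((tendsto_const_nhds (x := F ξ)).sub
    ((hF.tendsto ξ).comp hlim)) : Filter.Tendsto _ Filter.atTop _) hgap
  rw [sub_self] at h0
  linarith

theorem lastLetterDFA_accepts_mem_REG {α : Type*} [DecidableEq α] (a : α) :
    (lastLetterDFA a).accepts ∈ REG α :=
  ⟨Bool, inferInstance, lastLetterDFA a, rfl⟩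

/-! ### Inner products of finite superpositions -/

section FinsuppInner

open Matrix

variable {X Y : Type*}

/-- The inner product of two finite superpositions. -/
noncomputable def finsuppInner (f g : X →₀ ℂ) : ℂ :=
  Finsupp.linearCombination ℂ (fun c => star (f c)) g

/-- The squared norm of a finite superposition. -/
noncomputable def finsuppWt (f : X →₀ ℂ) : ℝ := f.sum fun _ a => ‖a‖ ^ 2

theorem finsuppInner_eq_sum (f g : X →₀ ℂ) {s : Finset X} (hs : g.support ⊆ s) :
    finsuppInner f g = ∑ c ∈ s, star (f c) * g c := by
  rw [finsuppInner, Finsupp.linearCombination_apply, Finsupp.sum_of_support_subset _ hs _ (by simp)]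
  simp [mul_comm]

theorem star_finsuppInner (f g : X →₀ ℂ) : star (finsuppInner f g) = finsuppInner g f := by
  classical
  rw [finsuppInner_eq_sum f g (Finset.subset_union_right (s₁ := f.support)),
    finsuppInner_eq_sum g f (Finset.subset_union_left (s₂ := g.support)), star_sum]
  simp [mul_comm]

theorem finsuppInner_self (f : X →₀ ℂ) : finsuppInner f f = (finsuppWt f : ℂ) := by
  rw [finsuppInner_eq_sum f f subset_rfl, finsuppWt, Finsupp.sum, Complex.ofReal_sum]
  refine Finset.sum_congr rfl fun c _ => ?_
  rw [RCLike.star_def, Complex.conj_mul']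
  simp

theorem finsuppInner_add_right (f g h : X →₀ ℂ) :
    finsuppInner f (g + h) = finsuppInner f g + finsuppInner f h := map_add _ _ _

theorem finsuppInner_smul_right (f g : X →₀ ℂ) (a : ℂ) :
    finsuppInner f (a • g) = a * finsuppInner f g := map_smul _ _ _

theorem finsuppInner_sum_right {ι : Type*} (f : X →₀ ℂ) (s : Finset ι) (g : ι → X →₀ ℂ) :
    finsuppInner f (∑ i ∈ s, g i) = ∑ i ∈ s, finsuppInner f (g i) := map_sum _ _ _

theorem finsuppInner_add_left (f g h : X →₀ ℂ) :
    finsuppInner (f + g) h = finsuppInner f h + finsuppInner g h := by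
  rw [← star_finsuppInner, finsuppInner_add_right, star_add, star_finsuppInner, star_finsuppInner]

theorem finsuppInner_smul_left (f g : X →₀ ℂ) (a : ℂ) :
    finsuppInner (a • f) g = star a * finsuppInner f g := by
  rw [← star_finsuppInner, finsuppInner_smul_right, star_mul', star_finsuppInner]

theorem finsuppInner_zero_left (g : X →₀ ℂ) : finsuppInner 0 g = 0 := by
  simpa using finsuppInner_smul_left 0 g 0

theorem finsuppInner_sum_left {ι : Type*} (g : X →₀ ℂ) (s : Finset ι) (f : ι → X →₀ ℂ) :
    finsuppInner (∑ i ∈ s, f i) g = ∑ i ∈ s, finsuppInner (f i) g := by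
  rw [← star_finsuppInner, finsuppInner_sum_right, star_sum]
  simp only [star_finsuppInner]

theorem finsuppInner_single_single_self (c : X) (a b : ℂ) :
    finsuppInner (Finsupp.single c a) (Finsupp.single c b) = star a * b := by
  simp [finsuppInner, mul_comm]

theorem finsuppInner_single_single_of_ne {c c' : X} (h : c ≠ c') (a b : ℂ) :
    finsuppInner (Finsupp.single c a) (Finsupp.single c' b) = 0 := by
  simp [finsuppInner, Finsupp.single_eq_of_ne h.symm]

/-- By sesquilinearity, orthonormality of the images of basis vectors suffices. -/
theorem finsuppInner_linearCombination {b : X → Y →₀ ℂ}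
    (hb : ∀ c c', finsuppInner (b c) (b c') =
      finsuppInner (Finsupp.single c 1) (Finsupp.single c' 1)) (f g : X →₀ ℂ) :
    finsuppInner (Finsupp.linearCombination ℂ b f) (Finsupp.linearCombination ℂ b g) =
      finsuppInner f g := by
  induction g using Finsupp.induction_linear with
  | zero => simp [finsuppInner]
  | add g h hg hh => rw [map_add, finsuppInner_add_right, hg, hh, finsuppInner_add_right]
  | single c' a' =>
    induction f using Finsupp.induction_linear with
    | zero =>
      rw [map_zero, finsuppInner_zero_left, finsuppInner_zero_left]
    | add g h hg hh => rw [map_add, finsuppInner_add_left, hg, hh, finsuppInner_add_left]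
    | single c a =>
      rw [Finsupp.linearCombination_single, Finsupp.linearCombination_single,
        finsuppInner_smul_left, finsuppInner_smul_right, hb, ← finsuppInner_smul_right,
        ← finsuppInner_smul_left]
      simp

/-- The operator `A ⊗ I` preserves inner products. Here `h c` is the part of the configuration `c`
on which the unitary matrix `A` acts, `r c` is the rest, and `g c w` arises from `c` by replacing
the former part by `w`. -/
theorem finsuppInner_linearCombination_unitary {W R : Type*} [Fintype W] [DecidableEq W]
    {A : Matrix W W ℂ} (hA : A ∈ Matrix.unitaryGroup W ℂ) {g : X → W → X} {h : X → W} {r : X → R}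
    (hg : ∀ c c' w w', g c w = g c' w' ↔ w = w' ∧ r c = r c')
    (hinj : ∀ c c', h c = h c' → r c = r c' → c = c') (f f' : X →₀ ℂ) :
    finsuppInner
      (Finsupp.linearCombination ℂ (fun c => ∑ w, Finsupp.single (g c w) (A w (h c))) f)
      (Finsupp.linearCombination ℂ (fun c => ∑ w, Finsupp.single (g c w) (A w (h c))) f') =
      finsuppInner f f' := by
  refine finsuppInner_linearCombination (fun c c' => ?_) f f'
  rw [finsuppInner_sum_left]
  simp only [finsuppInner_sum_right]
  by_cases hr : r c = r c'
  · have h1 : ∀ w, ∑ w', finsuppInner (Finsupp.single (g c w) (A w (h c)))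
        (Finsupp.single (g c' w') (A w' (h c'))) = star (A w (h c)) * A w (h c') := by
      intro w
      rw [Finset.sum_eq_single w, (hg c c' w w).2 ⟨rfl, hr⟩, finsuppInner_single_single_self]
      · intro w' _ hw'
        exact finsuppInner_single_single_of_ne (fun H => hw' ((hg _ _ _ _).1 H).1.symm) _ _
      · simp
    have h2 : ∑ w, star (A w (h c)) * A w (h c') = (star A * A) (h c) (h c') := by
      simp [mul_apply, star_apply]
    simp only [h1, h2, mem_unitaryGroup_iff'.1 hA, one_apply]
    split_ifs with hh
    · rw [hinj c c' hh hr, finsuppInner_single_single_self]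
      simp
    · rw [finsuppInner_single_single_of_ne]
      rintro rfl
      exact hh rfl
  · rw [finsuppInner_single_single_of_ne (by rintro rfl; exact hr rfl)]
    refine Finset.sum_eq_zero fun w _ => Finset.sum_eq_zero fun w' _ => ?_
    exact finsuppInner_single_single_of_ne (fun H => hr ((hg _ _ _ _).1 H).2) _ _

theorem finsuppWt_eq_of_finsuppInner_eq {f : X →₀ ℂ} {g : Y →₀ ℂ}
    (h : finsuppInner f f = finsuppInner g g) : finsuppWt f = finsuppWt g := by
  rw [finsuppInner_self, finsuppInner_self] at h
  exact_mod_cast h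

theorem finsuppWt_eq_sum (f : X →₀ ℂ) {s : Finset X} (hs : f.support ⊆ s) :
    finsuppWt f = ∑ c ∈ s, ‖f c‖ ^ 2 :=
  Finsupp.sum_of_support_subset _ hs _ (by simp)

variable {A T : Type*}

/-- The part of a finite superposition with first component `a`. -/
noncomputable def finsuppSlice (a : A) : (A × T →₀ ℂ) →ₗ[ℂ] T →₀ ℂ :=
  Finsupp.lcomapDomain (Prod.mk a) (Prod.mk_right_injective a)

theorem finsuppSlice_single_self (a : A) (t : T) (z : ℂ) :
    finsuppSlice a (Finsupp.single (a, t) z) = Finsupp.single t z :=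
  Finsupp.comapDomain_single _ _ _ _

theorem finsuppSlice_apply (a : A) (f : A × T →₀ ℂ) (t : T) : finsuppSlice a f t = f (a, t) := rfl

theorem finsuppSlice_single_of_ne {a a' : A} (h : a' ≠ a) (t : T) (z : ℂ) :
    finsuppSlice a (Finsupp.single (a', t) z) = 0 := by
  ext t'
  rw [finsuppSlice_apply, Finsupp.single_eq_of_ne (by simp [h.symm])]
  rfl

theorem finsuppInner_eq_sum_slice [Fintype A] (f g : A × T →₀ ℂ) :
    finsuppInner f g = ∑ a, finsuppInner (finsuppSlice a f) (finsuppSlice a g) := by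
  induction g using Finsupp.induction_linear with
  | zero => simp [finsuppInner]
  | add g h hg hh =>
    simp only [map_add, finsuppInner_add_right, hg, hh, Finset.sum_add_distrib]
  | single c z =>
    rw [Finset.sum_eq_single c.1, finsuppSlice_single_self]
    · simp [finsuppInner, finsuppSlice_apply]
    · intro a _ ha
      rw [finsuppSlice_single_of_ne ha.symm]
      simp [finsuppInner]
    · simp

end FinsuppInner

namespace PrivateTape

variable {Δ : Type} {blank : Δ}

/-- Blanking the first `k` cells encodes the untouched rest of the tape; it plays the role of `r` in
`finsuppInner_linearCombination_unitary`. -/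
theorem overwrite_eq_overwrite_iff {k : ℕ} (y y' : PrivateTape Δ blank) (u u' : Fin k → Δ) :
    overwrite u y = overwrite u' y' ↔
      u = u' ∧ overwrite (fun _ : Fin k => blank) y = overwrite (fun _ : Fin k => blank) y' := by
  simp only [overwrite, PrivateTape, Subtype.mk.injEq, funext_iff]
  constructor
  · intro h
    refine ⟨fun i => by simpa using h i, fun i => ?_⟩
    have := h i
    split_ifs at this ⊢
    · rfl
    · exact this
  · rintro ⟨h, h'⟩ i
    have := h' i
    split_ifs at this ⊢
    · exact h _
    · exact this

theorem eq_of_initial_eq {k : ℕ} {y y' : PrivateTape Δ blank} (h : initial k y = initial k y')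
    (h' : overwrite (fun _ : Fin k => blank) y = overwrite (fun _ : Fin k => blank) y') :
    y = y' := by
  refine Subtype.ext (funext fun i => ?_)
  by_cases hi : i < k
  · exact congrFun h ⟨i, hi⟩
  · have := congrFun (congrArg Subtype.val h') i
    simpa [overwrite, hi] using this

end PrivateTape

/-! ### One-way verifiers -/

namespace QfaVerifier

open Matrix

variable {α : Type*} {V : QfaVerifier α}

/-- The head of the verifier always moves to the right. -/
def MovesRight (V : QfaVerifier α) : Prop :=
  ∀ q σ γ q' γ' d, d ≠ 1 → V.δ q σ γ q' γ' d = 0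

/-- The amplitudes of a move to the right as matrices on the pairs of an inner state and a
communication symbol. -/
def trans (V : QfaVerifier α) (σ : TapeSymbol α) : Matrix (V.Q × V.Γ) (V.Q × V.Γ) ℂ :=
  fun v' v => V.δ v.1 σ v.2 v'.1 v'.2 1

theorem evolution_apply (hV : V.MovesRight) (x : List α) (c' c : V.Visible x.length) :
    V.evolution x c' c = if c'.2.1 = c.2.1 + 1 then
      V.trans (scanned x c.2.1) (c'.1, c'.2.2) (c.1, c.2.2) else 0 := by
  rw [evolution, Finset.sum_eq_single (1 : SignType)]
  · simp only [trans, SignType.coe_one]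
    congr
  · intro d _ hd
    simp [hV _ _ _ _ _ d hd]
  · simp

/-- Only the direction of the head is assumed, not halting, so that the criterion is independent of
the behaviour against provers. -/
theorem wellFormed_iff (hV : V.MovesRight) :
    V.WellFormed ↔ ∀ σ, V.trans σ ∈ Matrix.unitaryGroup (V.Q × V.Γ) ℂ := by
  have key : ∀ x, V.evolution x ∈ Matrix.unitaryGroup (V.Visible x.length) ℂ ↔
      ∀ k, V.trans (scanned x k) ∈ Matrix.unitaryGroup (V.Q × V.Γ) ℂ := by
    intro x
    let e : V.Visible x.length ≃ (V.Q × V.Γ) × ZMod (x.length + 2) :=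
      ⟨fun c => ((c.1, c.2.2), c.2.1), fun c => (c.1.1, c.2, c.1.2), fun _ => rfl, fun _ => rfl⟩
    rw [← shiftMatrix_mem_unitaryGroup_iff, ← submatrix_equiv_mem_unitaryGroup_iff e]
    have : V.evolution x = (shiftMatrix fun k => V.trans (scanned x k)).submatrix e e := by
      ext c' c
      rw [evolution_apply hV]
      rfl
    rw [this]
  constructor
  · intro h σ
    obtain ⟨x, k, rfl⟩ := exists_scanned_eq σ
    exact (key x).1 (h x) k
  · exact fun h x => (key x).2 fun k => h _

variable (V) (P : Prover α V.Γ)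

/-- Superpositions of configurations without the head position. -/
abbrev Local : Type := V.Q × V.Γ × PrivateTape P.Δ P.blank →₀ ℂ

/-- The verifier's move on configurations without the head position. -/
noncomputable def localMove (σ : TapeSymbol α) : V.Local P →ₗ[ℂ] V.Local P :=
  Finsupp.linearCombination ℂ fun (c : V.Q × V.Γ × PrivateTape P.Δ P.blank) =>
    ∑ v : V.Q × V.Γ, Finsupp.single (v.1, v.2, c.2.2) (V.trans σ v (c.1, c.2.1))

/-- The prover's operation on configurations without the head position. -/
noncomputable def localProver (x : List α) (i : ℕ) : V.Local P →ₗ[ℂ] V.Local P :=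
  Finsupp.linearCombination ℂ fun (c : V.Q × V.Γ × PrivateTape P.Δ P.blank) =>
    ∑ w : V.Γ × (Fin (P.cells x i) → P.Δ), Finsupp.single (c.1, w.1, c.2.2.overwrite w.2)
      ((P.op x i).1 w (c.2.1, c.2.2.initial (P.cells x i)))

/-- The prover's operation on communication cell and private tape alone. -/
noncomputable def proverCore (x : List α) (i : ℕ) :
    (V.Γ × PrivateTape P.Δ P.blank →₀ ℂ) →ₗ[ℂ] V.Γ × PrivateTape P.Δ P.blank →₀ ℂ :=
  Finsupp.linearCombination ℂ fun (c : V.Γ × PrivateTape P.Δ P.blank) =>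
    ∑ w : V.Γ × (Fin (P.cells x i) → P.Δ), Finsupp.single (w.1, c.2.overwrite w.2)
      ((P.op x i).1 w (c.1, c.2.initial (P.cells x i)))

/-- The measurement on configurations without the head position. -/
noncomputable def localProj (κ : StateKind) : V.Local P →ₗ[ℂ] V.Local P :=
  Finsupp.linearCombination ℂ fun (c : V.Q × V.Γ × PrivateTape P.Δ P.blank) =>
    if V.kind c.1 = κ then Finsupp.single c 1 else 0

/-- The computation of a one-way verifier on configurations without the head position. -/
noncomputable def localSystem : MeasuredSystem (TapeSymbol α) (V.Local P) where
  step σ := V.localMove P σ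
  proj κ := V.localProj P κ
  wt := finsuppWt

/-- Put the head into cell `t`. -/
noncomputable def atCell (n t : ℕ) : V.Local P →ₗ[ℂ] V.Superposition P n :=
  Finsupp.lmapDomain ℂ ℂ fun c => (c.1, (t : ZMod (n + 2)), c.2.1, c.2.2)

variable {V P}

theorem verifierMove_atCell (hV : V.MovesRight) (x : List α) (t : ℕ) (ψ : V.Local P) :
    V.verifierMove P x (V.atCell P x.length t ψ) =
      V.atCell P x.length (t + 1) (V.localMove P (scanned x t) ψ) := by
  suffices h : V.verifierMove P x ∘ₗ V.atCell P x.length t =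
      V.atCell P x.length (t + 1) ∘ₗ V.localMove P (scanned x t) from LinearMap.congr_fun h ψ
  refine Finsupp.lhom_ext fun c a => ?_
  simp only [LinearMap.comp_apply, atCell, verifierMove, localMove, Finsupp.lmapDomain_apply,
    Finsupp.mapDomain_single, Finsupp.linearCombination_single, Finsupp.mapDomain_smul,
    Finsupp.mapDomain_finsetSum]
  congr 1
  simp only [Fintype.sum_prod_type, evolution_apply hV]
  refine Finset.sum_congr rfl fun q _ => ?_
  rw [Finset.sum_eq_single ((t : ZMod (x.length + 2)) + 1)]
  · simp
  · intro k _ hk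
    simp [hk]
  · simp

theorem proverMove_atCell (x : List α) (i t : ℕ) (ψ : V.Local P) :
    V.proverMove P x i (V.atCell P x.length t ψ) =
      V.atCell P x.length t (V.localProver P x i ψ) := by
  suffices h : V.proverMove P x i ∘ₗ V.atCell P x.length t =
      V.atCell P x.length t ∘ₗ V.localProver P x i from LinearMap.congr_fun h ψ
  refine Finsupp.lhom_ext fun c a => ?_
  simp only [LinearMap.comp_apply, atCell, proverMove, localProver, Finsupp.lmapDomain_apply,
    Finsupp.mapDomain_single, Finsupp.linearCombination_single, Finsupp.mapDomain_smul,
    Finsupp.mapDomain_finsetSum]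

theorem proj_atCell (n t : ℕ) (κ : StateKind) (ψ : V.Local P) :
    V.proj P κ (V.atCell P n t ψ) = V.atCell P n t (V.localProj P κ ψ) := by
  suffices h : V.proj P κ ∘ₗ V.atCell P n t =
      V.atCell P n t ∘ₗ V.localProj P κ from LinearMap.congr_fun h ψ
  refine Finsupp.lhom_ext fun c a => ?_
  simp only [LinearMap.comp_apply, atCell, proj, localProj, Finsupp.lmapDomain_apply,
    Finsupp.mapDomain_single, Finsupp.linearCombination_single, Finsupp.mapDomain_smul]
  split_ifs <;> simp

theorem atCell_injective (n t : ℕ) : Function.Injective (V.atCell P n t) := by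
  refine Finsupp.mapDomain_injective ?_
  rintro ⟨q, γ, y⟩ ⟨q', γ', y'⟩ h
  simp only [Prod.mk.injEq] at h
  simp [h]

theorem finsuppWt_atCell (n t : ℕ) (ψ : V.Local P) :
    finsuppWt (V.atCell P n t ψ) = finsuppWt ψ := by
  refine Finsupp.sum_mapDomain_index_inj ?_
  rintro ⟨q, γ, y⟩ ⟨q', γ', y'⟩ h
  simp only [Prod.mk.injEq] at h
  simp [h]

theorem localProj_apply (κ : StateKind) (ψ : V.Local P)
    (c : V.Q × V.Γ × PrivateTape P.Δ P.blank) :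
    V.localProj P κ ψ c = if V.kind c.1 = κ then ψ c else 0 := by
  classical
  induction ψ using Finsupp.induction_linear with
  | zero => simp
  | add f g hf hg =>
    rw [map_add, Finsupp.add_apply, hf, hg, Finsupp.add_apply]
    split_ifs <;> simp
  | single c' a =>
    rw [localProj, Finsupp.linearCombination_single]
    by_cases h : c' = c
    · subst h
      split_ifs <;> simp
    · split_ifs <;> simp [h]

theorem finsuppInner_proverCore (x : List α) (i : ℕ)
    (ψ ψ' : V.Γ × PrivateTape P.Δ P.blank →₀ ℂ) :
    finsuppInner (V.proverCore P x i ψ) (V.proverCore P x i ψ') = finsuppInner ψ ψ' := by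
  have hg : ∀ (c c' : V.Γ × PrivateTape P.Δ P.blank) (w w' : V.Γ × (Fin (P.cells x i) → P.Δ)),
      (w.1, c.2.overwrite w.2) = (w'.1, c'.2.overwrite w'.2) ↔ w = w' ∧
        (c.2.overwrite fun _ : Fin (P.cells x i) => P.blank) =
          c'.2.overwrite fun _ : Fin (P.cells x i) => P.blank := by
    rintro ⟨γ, y⟩ ⟨γ', y'⟩ ⟨ρ, u⟩ ⟨ρ', u'⟩
    simp only [Prod.mk.injEq, PrivateTape.overwrite_eq_overwrite_iff y y' u u']
    tauto
  have hinj : ∀ c c' : V.Γ × PrivateTape P.Δ P.blank,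
      (c.1, c.2.initial (P.cells x i)) = (c'.1, c'.2.initial (P.cells x i)) →
      ((c.2.overwrite fun _ : Fin (P.cells x i) => P.blank) =
          c'.2.overwrite fun _ : Fin (P.cells x i) => P.blank) → c = c' := by
    rintro ⟨γ, y⟩ ⟨γ', y'⟩ h1 h2
    simp only [Prod.mk.injEq] at h1
    simp [h1.1, PrivateTape.eq_of_initial_eq h1.2 h2]
  rw [proverCore]
  exact finsuppInner_linearCombination_unitary (P.op x i).2 hg hinj ψ ψ'

theorem finsuppSlice_localProver (q : V.Q) (x : List α) (i : ℕ) (ψ : V.Local P) :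
    finsuppSlice q (V.localProver P x i ψ) = V.proverCore P x i (finsuppSlice q ψ) := by
  suffices h : finsuppSlice q ∘ₗ V.localProver P x i = V.proverCore P x i ∘ₗ finsuppSlice q from
    LinearMap.congr_fun h ψ
  refine Finsupp.lhom_ext fun c a => ?_
  obtain ⟨q', γ, y⟩ := c
  simp only [LinearMap.comp_apply, localProver, Finsupp.linearCombination_single, map_smul, map_sum]
  rcases eq_or_ne q' q with rfl | h
  · simp only [finsuppSlice_single_self, proverCore, Finsupp.linearCombination_single]
  · simp [finsuppSlice_single_of_ne h]

/-- The prover applies one isometry for all inner states, so overlaps between the parts at different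
inner states are preserved as well. The bounded simulation uses nothing else about his operation. -/
theorem finsuppInner_slice_localProver (q q' : V.Q) (x : List α) (i : ℕ) (ψ ψ' : V.Local P) :
    finsuppInner (finsuppSlice q (V.localProver P x i ψ))
      (finsuppSlice q' (V.localProver P x i ψ')) =
      finsuppInner (finsuppSlice q ψ) (finsuppSlice q' ψ') := by
  rw [finsuppSlice_localProver, finsuppSlice_localProver, finsuppInner_proverCore]

theorem finsuppInner_localProver (x : List α) (i : ℕ) (ψ ψ' : V.Local P) :
    finsuppInner (V.localProver P x i ψ) (V.localProver P x i ψ') = finsuppInner ψ ψ' := by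
  rw [finsuppInner_eq_sum_slice, finsuppInner_eq_sum_slice ψ]
  simp only [finsuppInner_slice_localProver]

theorem finsuppInner_localMove {σ : TapeSymbol α}
    (hσ : V.trans σ ∈ Matrix.unitaryGroup (V.Q × V.Γ) ℂ) (ψ ψ' : V.Local P) :
    finsuppInner (V.localMove P σ ψ) (V.localMove P σ ψ') = finsuppInner ψ ψ' := by
  refine finsuppInner_linearCombination_unitary hσ
    (g := fun c w => (w.1, w.2, c.2.2)) (h := fun c => (c.1, c.2.1)) (r := fun c => c.2.2) ?_ ?_ ψ ψ'
  · rintro ⟨q, γ, y⟩ ⟨q', γ', y'⟩ ⟨ρ, u⟩ ⟨ρ', u'⟩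
    simp only [Prod.mk.injEq]
    tauto
  · rintro ⟨q, γ, y⟩ ⟨q', γ', y'⟩ h1 h2
    simp_all

theorem localSystem_conserves (hV : ∀ σ, V.trans σ ∈ Matrix.unitaryGroup (V.Q × V.Γ) ℂ)
    (x : List α) : (V.localSystem P).Conserves fun i => V.localProver P x i where
  step σ ψ := finsuppWt_eq_of_finsuppInner_eq (finsuppInner_localMove (hV σ) ψ ψ)
  op i ψ := finsuppWt_eq_of_finsuppInner_eq (finsuppInner_localProver x i ψ ψ)
  split ψ := by
    have hs : ∀ κ, (V.localProj P κ ψ).support ⊆ ψ.support := by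
      intro κ c
      rw [Finsupp.mem_support_iff, Finsupp.mem_support_iff, localProj_apply]
      split_ifs <;> simp
    simp only [localSystem, finsuppWt_eq_sum _ (hs _), finsuppWt_eq_sum ψ subset_rfl,
      ← Finset.sum_add_distrib, localProj_apply]
    refine Finset.sum_congr rfl fun c _ => ?_
    cases V.kind c.1 <;> simp

variable (V P) in
/-- The initial superposition without the head position. -/
noncomputable def localStart : V.Local P :=
  Finsupp.single (V.start, V.blank, PrivateTape.allBlank) 1

theorem state_zero_eq (x : List α) :
    V.state P x 0 = V.atCell P x.length 0 (V.localStart P) := by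
  simp [state, atCell, localStart, Finsupp.mapDomain_single]

theorem outcome_atCell (hV : V.MovesRight) (κ : StateKind) (x : List α) {t : ℕ}
    (ht : t < (inputTape x).length) {ψ : V.Local P}
    (hψ : V.state P x t = V.atCell P x.length t ψ) :
    V.outcome P κ x t = V.atCell P x.length (t + 1)
      ((V.localSystem P).proj κ ((V.localSystem P).step (inputTape x)[t] ψ)) := by
  rw [outcome, hψ, verifierMove_atCell hV, proj_atCell, scanned_natCast x ht]
  rfl

/-- Prefixes `u` are allowed because the halting proof for the DFA verifier inspects the state just
before the right endmarker. -/
theorem sum_probAt_eq (hV : V.MovesRight) (κ : StateKind) (x : List α) {u : List (TapeSymbol α)}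
    (hu : u <+: inputTape x) :
    ∑ t ∈ Finset.range u.length, V.probAt P κ x t =
        (V.localSystem P).prob κ u (fun i => V.localProver P x i) (V.localStart P) ∧
      V.state P x u.length = V.atCell P x.length u.length
        ((V.localSystem P).run u (fun i => V.localProver P x i) (V.localStart P)) := by
  refine (V.localSystem P).sum_eq_prob κ u _ (V.localStart P) (V.state P x)
    (V.probAt P κ x) (fun t => V.atCell P x.length t) (state_zero_eq x) ?_
  intro t ht ψ hψ
  have h := fun κ => outcome_atCell hV κ x (ht.trans_le hu.length_le) hψ
  simp only [← hu.getElem ht] at h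
  constructor
  · rw [state, ← outcome, h, proverMove_atCell]
  · rw [probAt, h]
    exact finsuppWt_atCell _ _ _

theorem state_eq_zero (hV : V.IsOneWay) (x : List α) (t : ℕ) (ht : x.length + 2 ≤ t) :
    V.state P x t = 0 := by
  induction t, ht using Nat.le_induction with
  | base =>
    have h := hV.2 P x
    rw [outcome] at h
    rw [state, h, map_zero]
  | succ t _ ih => rw [state, ih, map_zero, map_zero, map_zero]

theorem tsum_probAt (hV : V.IsOneWay) (κ : StateKind) (x : List α) :
    ∑' t, V.probAt P κ x t =
      (V.localSystem P).prob κ (inputTape x) (fun i => V.localProver P x i) (V.localStart P) := by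
  rw [← (sum_probAt_eq hV.1 κ x List.prefix_rfl).1]
  refine tsum_eq_sum fun t ht => ?_
  rw [Finset.mem_range, not_lt, length_inputTape] at ht
  simp [probAt, outcome, state_eq_zero hV x t ht]

theorem pAcc_add_pRej (hwf : V.WellFormed) (hV : V.IsOneWay) (x : List α) :
    V.pAcc P x + V.pRej P x = 1 := by
  have h := (localSystem_conserves (P := P) ((wellFormed_iff hV.1).1 hwf) x).total
    (u := inputTape x) (V.localStart P)
  have h0 := (sum_probAt_eq (P := P) hV.1 StateKind.acc x List.prefix_rfl).2
  rw [state_eq_zero hV x _ (length_inputTape x).ge] at h0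
  rw [atCell_injective _ _ (h0.symm.trans (map_zero _).symm)] at h
  rw [pAcc, pRej, tsum_probAt hV, tsum_probAt hV]
  simpa [localSystem, localStart, finsuppWt] using h

end QfaVerifier

/-! ### Gram matrices -/

section Gram

open Matrix
open scoped MatrixOrder ComplexOrder

/-- Two families of vectors with the same Gram matrix differ by a unitary. -/
theorem exists_unitary_mul_eq {m n : Type*} [Fintype m] [DecidableEq m] [Fintype n] [DecidableEq n]
    {A B : Matrix m n ℂ} (h : Aᴴ * A = Bᴴ * B) : ∃ U ∈ Matrix.unitaryGroup m ℂ, U * A = B := by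
  let f := toEuclideanLin (𝕜 := ℂ) A
  let g := toEuclideanLin (𝕜 := ℂ) B
  have hnorm : ∀ (D : Matrix m n ℂ) (a : EuclideanSpace ℂ n),
      ((‖toEuclideanLin D a‖ ^ 2 : ℝ) : ℂ) = star a.ofLp ⬝ᵥ ((Dᴴ * D) *ᵥ a.ofLp) := by
    intro D a
    rw [EuclideanSpace.norm_sq_eq, sum_norm_sq_eq_star_dotProduct, toLpLin_apply, star_mulVec,
      ← dotProduct_mulVec, mulVec_mulVec]
  have hfg : ∀ a, ‖g a‖ = ‖f a‖ := by
    intro a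
    have h1 : ((‖g a‖ ^ 2 : ℝ) : ℂ) = ((‖f a‖ ^ 2 : ℝ) : ℂ) := by
      rw [hnorm A a, hnorm B a, h]
    exact (pow_left_inj₀ (norm_nonneg _) (norm_nonneg _) two_ne_zero).1 (by exact_mod_cast h1)
  -- Equality of norms makes `A a ↦ B a` a well-defined isometry on the range of `A`; it extends to
  -- the whole space, and there it is surjective by finite dimension.
  have hker : LinearMap.ker f ≤ LinearMap.ker g := by
    intro a ha
    rw [LinearMap.mem_ker] at ha ⊢
    rw [← norm_eq_zero, hfg, ha, norm_zero]
  let l : LinearMap.range f →ₗ[ℂ] EuclideanSpace ℂ m :=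
    (LinearMap.ker f).liftQ g hker ∘ₗ f.quotKerEquivRange.symm.toLinearMap
  have hl : ∀ a, l ⟨f a, LinearMap.mem_range_self f a⟩ = g a := by
    intro a
    simp only [l, LinearMap.comp_apply, LinearEquiv.coe_coe,
      LinearMap.quotKerEquivRange_symm_apply_image]
    simp
  let L : LinearMap.range f →ₗᵢ[ℂ] EuclideanSpace ℂ m :=
    { toLinearMap := l
      norm_map' := by
        rintro ⟨_, a, rfl⟩
        rw [hl, hfg]
        rfl }
  let T := Unitary.linearIsometryEquiv.symm (L.extend.toLinearIsometryEquiv rfl)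
  refine ⟨(toEuclideanCLM (𝕜 := ℂ) (n := m)).symm T.1, Unitary.map_mem _ T.2, ?_⟩
  apply (toEuclideanLin (𝕜 := ℂ)).injective
  refine LinearMap.ext fun a => ?_
  have h1 : T.1 (f a) = g a := (L.extend_apply ⟨f a, LinearMap.mem_range_self f a⟩).trans (hl a)
  have h2 := toEuclideanCLM_toLp ((toEuclideanCLM (𝕜 := ℂ) (n := m)).symm T.1) (A *ᵥ a.ofLp)
  rw [StarAlgEquiv.apply_symm_apply] at h2
  rw [toLpLin_apply, ← mulVec_mulVec, ← h2]
  exact h1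

/-- A Gram matrix of finite superpositions is realized in dimension equal to its size. -/
theorem exists_gram_eq {ι T : Type*} [Fintype ι] [DecidableEq ι] (b : ι → T →₀ ℂ) :
    ∃ Z : Matrix ι ι ℂ, ∀ v v', finsuppInner (b v) (b v') = ∑ w, star (Z w v) * Z w v' := by
  have hpos : (Matrix.of fun v v' => finsuppInner (b v) (b v')).PosSemidef := by
    refine PosSemidef.of_dotProduct_mulVec_nonneg ?_ fun a => ?_
    · ext v v'
      exact star_finsuppInner _ _
    · have h : star a ⬝ᵥ ((Matrix.of fun v v' => finsuppInner (b v) (b v')) *ᵥ a) =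
          finsuppInner (∑ v, a v • b v) (∑ v, a v • b v) := by
        rw [finsuppInner_sum_left]
        simp only [dotProduct, mulVec, finsuppInner_sum_right, finsuppInner_smul_left,
          finsuppInner_smul_right, Pi.star_apply, of_apply]
        refine Finset.sum_congr rfl fun v _ => ?_
        rw [Finset.mul_sum]
        exact Finset.sum_congr rfl fun v' _ => by ring
      rw [h, finsuppInner_self]
      exact Complex.zero_le_real.2 (Finsupp.sum_nonneg fun _ _ => by positivity)
  -- The columns of `Z` are the required vectors.
  obtain ⟨Z, hZ⟩ := CStarAlgebra.nonneg_iff_eq_star_mul_self.1 (nonneg_iff_posSemidef.2 hpos)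
  refine ⟨Z, fun v v' => ?_⟩
  have := congrFun (congrFun hZ v) v'
  simpa [mul_apply, star_apply] using this

end Gram

/-! ### Bounding the private space of the prover -/

namespace QfaVerifier

open Matrix
open scoped Kronecker

variable {α : Type*} (V : QfaVerifier α)

/-- The private space that suffices for every prover. -/
abbrev Memory : Type := V.Q × V.Γ

/-- The verifier's move, tensored with the identity on the bounded private space. -/
noncomputable def boundedStep (σ : TapeSymbol α) :
    Matrix (V.Q × V.Γ × V.Memory) (V.Q × V.Γ × V.Memory) ℂ :=
  (V.trans σ ⊗ₖ (1 : Matrix V.Memory V.Memory ℂ)).submatrix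
    (Equiv.prodAssoc _ _ _).symm (Equiv.prodAssoc _ _ _).symm

/-- An operation of the prover, tensored with the identity on the verifier's inner state. -/
noncomputable def boundedOp (U : Matrix (V.Γ × V.Memory) (V.Γ × V.Memory) ℂ) :
    Matrix (V.Q × V.Γ × V.Memory) (V.Q × V.Γ × V.Memory) ℂ :=
  (1 : Matrix V.Q V.Q ℂ) ⊗ₖ U

/-- All operations of provers with the bounded private space. -/
def boundedOps : Set (Matrix (V.Q × V.Γ × V.Memory) (V.Q × V.Γ × V.Memory) ℂ) :=
  V.boundedOp '' Matrix.unitaryGroup (V.Γ × V.Memory) ℂ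

/-- The computation against provers with the bounded private space. -/
noncomputable def boundedSystem :
    MeasuredSystem (TapeSymbol α) (V.Q × V.Γ × V.Memory → ℂ) :=
  vecSystem V.boundedStep fun c => V.kind c.1

/-- The initial superposition with the bounded private space. -/
def boundedStart : V.Q × V.Γ × V.Memory → ℂ :=
  Pi.single (V.start, V.blank, (V.start, V.blank)) 1

variable {V}

theorem boundedStep_mem_unitaryGroup {σ : TapeSymbol α}
    (h : V.trans σ ∈ Matrix.unitaryGroup (V.Q × V.Γ) ℂ) :
    V.boundedStep σ ∈ Matrix.unitaryGroup (V.Q × V.Γ × V.Memory) ℂ :=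
  (submatrix_equiv_mem_unitaryGroup_iff _ _).2 (kronecker_mem_unitary h (one_mem _))

theorem boundedOps_subset_unitaryGroup (C) (hC : C ∈ V.boundedOps) :
    C ∈ Matrix.unitaryGroup (V.Q × V.Γ × V.Memory) ℂ := by
  obtain ⟨U, hU, rfl⟩ := hC
  exact kronecker_mem_unitary (one_mem _) hU

theorem boundedStep_mulVec (σ : TapeSymbol α) (φ : V.Q × V.Γ × V.Memory → ℂ)
    (c : V.Q × V.Γ × V.Memory) :
    (V.boundedStep σ *ᵥ φ) c =
      ∑ u : V.Q × V.Γ, V.trans σ (c.1, c.2.1) u * φ (u.1, u.2, c.2.2) := by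
  rw [mulVec, dotProduct, ← (Equiv.prodAssoc V.Q V.Γ V.Memory).sum_comp, Fintype.sum_prod_type]
  refine Finset.sum_congr rfl fun u _ => ?_
  rw [Finset.sum_eq_single c.2.2]
  · simp [boundedStep, kroneckerMap_apply]
  · intro w _ hw
    simp [boundedStep, kroneckerMap_apply, one_apply_ne hw.symm]
  · simp

theorem boundedOp_mulVec (U : Matrix (V.Γ × V.Memory) (V.Γ × V.Memory) ℂ)
    (φ : V.Q × V.Γ × V.Memory → ℂ) (c : V.Q × V.Γ × V.Memory) :
    (V.boundedOp U *ᵥ φ) c = ∑ p, U c.2 p * φ (c.1, p) := by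
  rw [mulVec, dotProduct, Fintype.sum_prod_type, Finset.sum_eq_single c.1]
  · simp [boundedOp, kroneckerMap_apply]
  · intro q _ hq
    simp [boundedOp, kroneckerMap_apply, one_apply_ne hq.symm]
  · simp

variable {P : Prover α V.Γ}

/-- The component of a local superposition at an inner state and a communication symbol. -/
noncomputable def row (ψ : V.Local P) (v : V.Q × V.Γ) : PrivateTape P.Δ P.blank →₀ ℂ :=
  finsuppSlice v.2 (finsuppSlice v.1 ψ)

/-- `ψ` and `φ` have the same reduced state on inner states and communication symbols. -/
def SameGram (ψ : V.Local P) (φ : V.Q × V.Γ × V.Memory → ℂ) : Prop :=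
  ∀ v v' : V.Q × V.Γ, finsuppInner (row ψ v) (row ψ v') =
    ∑ w, star (φ (v.1, v.2, w)) * φ (v'.1, v'.2, w)

theorem row_localMove (σ : TapeSymbol α) (ψ : V.Local P) (v : V.Q × V.Γ) :
    row (V.localMove P σ ψ) v = ∑ u, V.trans σ v u • row ψ u := by
  suffices h : finsuppSlice v.2 ∘ₗ finsuppSlice v.1 ∘ₗ V.localMove P σ =
      ∑ u : V.Q × V.Γ, V.trans σ v u • (finsuppSlice u.2 ∘ₗ finsuppSlice u.1) by
    have := LinearMap.congr_fun h ψ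
    simpa [LinearMap.sum_apply, row] using this
  refine Finsupp.lhom_ext fun c a => ?_
  obtain ⟨q, γ, y⟩ := c
  have h1 : ∀ (u u' : V.Q × V.Γ) (z : ℂ), finsuppSlice u.2 (finsuppSlice u.1
      (Finsupp.single (u'.1, u'.2, y) z)) = if u' = u then Finsupp.single y z else 0 := by
    rintro ⟨q₁, γ₁⟩ ⟨q₂, γ₂⟩ z
    rcases eq_or_ne q₂ q₁ with rfl | hq
    · rcases eq_or_ne γ₂ γ₁ with rfl | hγ
      · simp [finsuppSlice_single_self]
      · simp [finsuppSlice_single_self, finsuppSlice_single_of_ne hγ, hγ]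
    · simp [finsuppSlice_single_of_ne hq, hq]
  have h2 := fun u : V.Q × V.Γ => h1 u (q, γ) a
  simp only at h2
  simp only [LinearMap.comp_apply, localMove, Finsupp.linearCombination_single, map_smul, map_sum,
    h1, LinearMap.sum_apply, LinearMap.smul_apply, h2]
  simp [mul_comm]

theorem SameGram.step {ψ : V.Local P} {φ : V.Q × V.Γ × V.Memory → ℂ} (h : SameGram ψ φ)
    (σ : TapeSymbol α) : SameGram (V.localMove P σ ψ) (V.boundedStep σ *ᵥ φ) := by
  intro v v'
  simp only [row_localMove, boundedStep_mulVec]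
  rw [finsuppInner_sum_left]
  simp only [finsuppInner_sum_right, finsuppInner_smul_left, finsuppInner_smul_right, h _ _,
    star_sum, star_mul', Finset.sum_mul_sum]
  simp only [Finset.mul_sum]
  conv_rhs => rw [Finset.sum_comm]
  refine Finset.sum_congr rfl fun u _ => ?_
  conv_rhs => rw [Finset.sum_comm]
  exact Finset.sum_congr rfl fun u' _ => Finset.sum_congr rfl fun w _ => by ring

theorem SameGram.proj {ψ : V.Local P} {φ : V.Q × V.Γ × V.Memory → ℂ} (h : SameGram ψ φ)
    (κ : StateKind) : SameGram (V.localProj P κ ψ) (V.boundedSystem.proj κ φ) := by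
  have h1 : ∀ v, row (V.localProj P κ ψ) v = if V.kind v.1 = κ then row ψ v else 0 := by
    intro v
    ext y
    simp only [row, finsuppSlice_apply, localProj_apply]
    split_ifs <;> rfl
  intro v v'
  simp only [h1, boundedSystem, vecSystem]
  split_ifs
  · exact h v v'
  all_goals simp [finsuppInner, ← Pi.zero_def]

/-- The weight is the trace of the Gram matrix. -/
theorem SameGram.wt {ψ : V.Local P} {φ : V.Q × V.Γ × V.Memory → ℂ} (h : SameGram ψ φ) :
    finsuppWt ψ = V.boundedSystem.wt φ := by
  have h1 : finsuppInner ψ ψ = ((V.boundedSystem.wt φ : ℝ) : ℂ) := by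
    rw [finsuppInner_eq_sum_slice]
    simp only [finsuppInner_eq_sum_slice (finsuppSlice _ ψ)]
    simp only [boundedSystem, vecSystem, sum_norm_sq_eq_star_dotProduct, dotProduct,
      Fintype.sum_prod_type (f := fun c : V.Q × V.Γ × V.Memory => star φ c * φ c)]
    refine Finset.sum_congr rfl fun q _ => ?_
    rw [Fintype.sum_prod_type]
    exact Finset.sum_congr rfl fun γ _ => h (q, γ) (q, γ)
  rw [finsuppInner_self] at h1
  exact_mod_cast h1

/-- The heart of the simulation. `Z` realizes the Gram matrix after the prover's operation in
`Memory`. Summing over communication symbols gives the Gram matrix indexed by inner states alone,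
which the prover cannot change; so `φ` and `Z`, read as `|Q|` vectors over `Γ × Memory`, differ by a
unitary there. -/
theorem SameGram.exists_op {ψ : V.Local P} {φ : V.Q × V.Γ × V.Memory → ℂ} (h : SameGram ψ φ)
    (x : List α) (i : ℕ) :
    ∃ C ∈ V.boundedOps, SameGram (V.localProver P x i ψ) (C *ᵥ φ) := by
  obtain ⟨Z, hZ⟩ := exists_gram_eq (row (V.localProver P x i ψ))
  let A : Matrix (V.Γ × V.Memory) V.Q ℂ := fun p q => φ (q, p)
  let B : Matrix (V.Γ × V.Memory) V.Q ℂ := fun p q => Z p.2 (q, p.1)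
  have hAB : Aᴴ * A = Bᴴ * B := by
    ext q q'
    have h1 := finsuppInner_slice_localProver q q' x i ψ ψ
    rw [finsuppInner_eq_sum_slice, finsuppInner_eq_sum_slice (finsuppSlice q ψ)] at h1
    change ∑ p : V.Γ × V.Memory, star (φ (q, p)) * φ (q', p) =
      ∑ p : V.Γ × V.Memory, star (Z p.2 (q, p.1)) * Z p.2 (q', p.1)
    rw [Fintype.sum_prod_type, Fintype.sum_prod_type]
    calc _ = ∑ γ, finsuppInner (row ψ (q, γ)) (row ψ (q', γ)) :=
          Finset.sum_congr rfl fun γ _ => (h (q, γ) (q', γ)).symm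
      _ = _ := h1.symm
      _ = _ := Finset.sum_congr rfl fun γ _ => hZ (q, γ) (q', γ)
  obtain ⟨U, hU, hUA⟩ := exists_unitary_mul_eq hAB
  refine ⟨_, ⟨U, hU, rfl⟩, fun v v' => ?_⟩
  have h2 : ∀ q p, (V.boundedOp U *ᵥ φ) (q, p) = Z p.2 (q, p.1) := by
    intro q p
    rw [boundedOp_mulVec]
    exact congrFun (congrFun hUA p) q
  simp only [h2]
  exact hZ v v'

theorem sameGram_start : SameGram (V.localStart P) V.boundedStart := by
  have h1 : ∀ v : V.Q × V.Γ, row (V.localStart P) v =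
      if v = (V.start, V.blank) then Finsupp.single PrivateTape.allBlank 1 else 0 := by
    rintro ⟨q, γ⟩
    simp only [row, localStart, Prod.mk.injEq]
    rcases eq_or_ne V.start q with rfl | hq
    · rcases eq_or_ne V.blank γ with rfl | hγ
      · simp [finsuppSlice_single_self]
      · simp [finsuppSlice_single_self, finsuppSlice_single_of_ne hγ, hγ.symm]
    · simp [finsuppSlice_single_of_ne hq, hq.symm]
  intro v v'
  simp only [h1, boundedStart, Pi.single_apply]
  obtain ⟨q, γ⟩ := v
  obtain ⟨q', γ'⟩ := v'
  simp only [Prod.mk.injEq]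
  by_cases hv : q = V.start ∧ γ = V.blank
  · by_cases hv' : q' = V.start ∧ γ' = V.blank
    · simp [hv, hv', finsuppInner_single_single_self]
    · have : ∀ w, ¬ (q' = V.start ∧ γ' = V.blank ∧ w = (V.start, V.blank)) := by tauto
      simp [hv', this, finsuppInner]
  · have : ∀ w, ¬ (q = V.start ∧ γ = V.blank ∧ w = (V.start, V.blank)) := by tauto
    simp [hv, this, finsuppInner_zero_left]

/-- Every prover is simulated by one with the bounded private space. -/
theorem exists_bounded_strategy (x : List α) (u : List (TapeSymbol α)) (j : ℕ) {ψ : V.Local P}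
    {φ : V.Q × V.Γ × V.Memory → ℂ} (h : SameGram ψ φ) :
    ∃ C : ℕ → Matrix _ _ ℂ, (∀ i, C i ∈ V.boundedOps) ∧
      (V.localSystem P).prob StateKind.acc u (fun i => V.localProver P x (i + j)) ψ =
        V.boundedSystem.prob StateKind.acc u (fun i φ => C i *ᵥ φ) φ := by
  induction u generalizing j ψ φ with
  | nil => exact ⟨fun _ => V.boundedOp 1, fun _ => ⟨1, one_mem _, rfl⟩, rfl⟩
  | cons σ u ih =>
    have h1 := (h.step σ).proj StateKind.non
    obtain ⟨C₀, hC₀, h2⟩ := h1.exists_op x j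
    obtain ⟨C, hC, h3⟩ := ih (j + 1) h2
    refine ⟨fun i => Nat.casesOn i C₀ C, fun i => by cases i <;> simp [hC₀, hC], ?_⟩
    simp only [MeasuredSystem.prob, Nat.zero_add]
    congr 1
    · exact ((h.step σ).proj StateKind.acc).wt
    · have : (fun i => ⇑(V.localProver P x (i + 1 + j))) =
          fun i => ⇑(V.localProver P x (i + (j + 1))) := by
        ext1 i
        rw [add_assoc, add_comm 1 j]
      rw [this]
      exact h3

end QfaVerifier

/-! ### Carrying out bounded strategies by actual provers -/

namespace QfaVerifier

open Matrix

variable {α : Type*} {V : QfaVerifier α}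

variable (V) in
/-- The prover who keeps the bounded private space in the first cell of his tape and applies the
given unitaries. -/
noncomputable abbrev boundedProver (U : ℕ → Matrix.unitaryGroup (V.Γ × V.Memory) ℂ) :
    Prover α V.Γ where
  Δ := V.Memory
  blank := (V.start, V.blank)
  cells _ _ := 1
  op _ i := ⟨(U i).1.submatrix ((Equiv.refl V.Γ).prodCongr (Equiv.funUnique (Fin 1) V.Memory))
      ((Equiv.refl V.Γ).prodCongr (Equiv.funUnique (Fin 1) V.Memory)),
    (submatrix_equiv_mem_unitaryGroup_iff _ _).2 (U i).2⟩

variable (U : ℕ → Matrix.unitaryGroup (V.Γ × V.Memory) ℂ)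

/-- The private tape with content `w` in the first cell. -/
noncomputable def memoryTape (w : V.Memory) :
    PrivateTape (V.boundedProver U).Δ (V.boundedProver U).blank :=
  PrivateTape.allBlank.overwrite fun _ : Fin 1 => w

theorem memoryTape_injective : Function.Injective (memoryTape U) := by
  intro w w' h
  have := congrFun (congrArg Subtype.val h) 0
  simpa [memoryTape, PrivateTape.overwrite] using this

/-- The tape blank is the memory content in `boundedStart`, so both computations start in
corresponding states. -/
theorem memoryTape_blank : memoryTape U (V.start, V.blank) = PrivateTape.allBlank := by
  refine Subtype.ext (funext fun i => ?_)
  simp only [memoryTape, PrivateTape.overwrite, PrivateTape.allBlank]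
  split_ifs <;> rfl

theorem overwrite_memoryTape (w : V.Memory) (u : Fin 1 → V.Memory) :
    (memoryTape U w).overwrite u = memoryTape U (u 0) := by
  refine Subtype.ext (funext fun i => ?_)
  simp only [memoryTape, PrivateTape.overwrite]
  split_ifs with hi
  · exact congrArg u (Subsingleton.elim _ _)
  · rfl

/-- A superposition with the bounded private space as a superposition with a private tape. -/
noncomputable def onTape : (V.Q × V.Γ × V.Memory → ℂ) →ₗ[ℂ] V.Local (V.boundedProver U) :=
  Fintype.linearCombination ℂ fun c => Finsupp.single (c.1, c.2.1, memoryTape U c.2.2) (1 : ℂ)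

theorem onTape_apply (φ : V.Q × V.Γ × V.Memory → ℂ) :
    onTape U φ = ∑ c : V.Q × V.Γ × V.Memory,
      Finsupp.single (c.1, c.2.1, memoryTape U c.2.2) (φ c) := by
  simp [onTape, Fintype.linearCombination_apply]

theorem localMove_onTape (σ : TapeSymbol α) (φ : V.Q × V.Γ × V.Memory → ℂ) :
    V.localMove _ σ (onTape U φ) = onTape U (V.boundedStep σ *ᵥ φ) := by
  have h1 : V.localMove _ σ (onTape U φ) = ∑ c : V.Q × V.Γ × V.Memory, ∑ v : V.Q × V.Γ,
      Finsupp.single (v.1, v.2, memoryTape U c.2.2) (V.trans σ v (c.1, c.2.1) * φ c) := by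
    rw [onTape_apply, map_sum]
    refine Finset.sum_congr rfl fun c _ => ?_
    rw [localMove, Finsupp.linearCombination_single, Finset.smul_sum]
    refine Finset.sum_congr rfl fun v _ => ?_
    rw [Finsupp.smul_single, smul_eq_mul, mul_comm]
  rw [h1, onTape_apply]
  simp only [boundedStep_mulVec, Finsupp.single_finsetSum]
  have hsum : ∀ F : V.Q × V.Γ → V.Memory → V.Local (V.boundedProver U),
      ∑ c : V.Q × V.Γ × V.Memory, F (c.1, c.2.1) c.2.2 = ∑ w, ∑ v, F v w := by
    intro F
    rw [← (Equiv.prodAssoc V.Q V.Γ V.Memory).sum_comp]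
    exact Fintype.sum_prod_type_right' fun v w => F v w
  rw [hsum fun u w => ∑ v : V.Q × V.Γ, Finsupp.single (v.1, v.2, memoryTape U w)
      (V.trans σ v u * φ (u.1, u.2, w)),
    hsum fun v w => ∑ u : V.Q × V.Γ, Finsupp.single (v.1, v.2, memoryTape U w)
      (V.trans σ v u * φ (u.1, u.2, w))]
  exact Finset.sum_congr rfl fun w _ => Finset.sum_comm

theorem localProver_onTape (x : List α) (i : ℕ) (φ : V.Q × V.Γ × V.Memory → ℂ) :
    V.localProver _ x i (onTape U φ) = onTape U (V.boundedOp (U i).1 *ᵥ φ) := by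
  have h1 : V.localProver _ x i (onTape U φ) = ∑ c : V.Q × V.Γ × V.Memory, ∑ p : V.Γ × V.Memory,
      Finsupp.single (c.1, p.1, memoryTape U p.2) ((U i).1 p c.2 * φ c) := by
    rw [onTape_apply, map_sum]
    refine Finset.sum_congr rfl fun c _ => ?_
    rw [localProver, Finsupp.linearCombination_single, Finset.smul_sum,
      ← ((Equiv.refl V.Γ).prodCongr (Equiv.funUnique (Fin 1) V.Memory)).sum_comp]
    refine Finset.sum_congr rfl fun p _ => ?_
    rw [Finsupp.smul_single, smul_eq_mul, mul_comm]
    have h2 : (memoryTape U c.2.2).overwrite p.2 = memoryTape U (p.2 0) :=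
      overwrite_memoryTape U _ _
    simp only [h2]
    congr 2
  rw [h1, onTape_apply]
  simp only [boundedOp_mulVec, Finsupp.single_finsetSum]
  rw [Fintype.sum_prod_type, Fintype.sum_prod_type]
  refine Finset.sum_congr rfl fun q _ => ?_
  exact Finset.sum_comm

theorem onTape_index_injective : Function.Injective fun c : V.Q × V.Γ × V.Memory =>
    (c.1, c.2.1, memoryTape U c.2.2) := by
  rintro ⟨q, γ, w⟩ ⟨q', γ', w'⟩ h
  simp only [Prod.mk.injEq] at h
  simp [h.1, h.2.1, memoryTape_injective U h.2.2]

theorem localProj_onTape (κ : StateKind) (φ : V.Q × V.Γ × V.Memory → ℂ) :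
    V.localProj _ κ (onTape U φ) = onTape U (V.boundedSystem.proj κ φ) := by
  rw [onTape_apply, onTape_apply, map_sum]
  refine Finset.sum_congr rfl fun c _ => ?_
  rw [localProj, Finsupp.linearCombination_single]
  simp only [boundedSystem, vecSystem]
  split_ifs <;> simp

theorem finsuppWt_onTape (φ : V.Q × V.Γ × V.Memory → ℂ) :
    finsuppWt (onTape U φ) = V.boundedSystem.wt φ := by
  have h1 : finsuppInner (onTape U φ) (onTape U φ) = ((V.boundedSystem.wt φ : ℝ) : ℂ) := by
    rw [onTape_apply, finsuppInner_sum_left]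
    simp only [finsuppInner_sum_right, boundedSystem, vecSystem, sum_norm_sq_eq_star_dotProduct,
      dotProduct]
    refine Finset.sum_congr rfl fun c _ => ?_
    rw [Finset.sum_eq_single c]
    · exact finsuppInner_single_single_self _ _ _
    · intro c' _ hc'
      exact finsuppInner_single_single_of_ne ((onTape_index_injective U).ne hc'.symm) _ _
    · simp
  rw [finsuppInner_self] at h1
  exact_mod_cast h1

theorem prob_onTape (κ : StateKind) (x : List α) (u : List (TapeSymbol α)) (j : ℕ)
    (φ : V.Q × V.Γ × V.Memory → ℂ) :
    (V.localSystem (V.boundedProver U)).prob κ u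
        (fun i => V.localProver (V.boundedProver U) x (i + j)) (onTape U φ) =
      V.boundedSystem.prob κ u (fun i φ => V.boundedOp (U (i + j)).1 *ᵥ φ) φ := by
  induction u generalizing j φ with
  | nil => rfl
  | cons σ u ih =>
    have hs : (V.localSystem (V.boundedProver U)).step σ (onTape U φ) =
        onTape U (V.boundedSystem.step σ φ) := localMove_onTape U σ φ
    have hp : ∀ (κ : StateKind) φ, (V.localSystem (V.boundedProver U)).proj κ (onTape U φ) =
        onTape U (V.boundedSystem.proj κ φ) := localProj_onTape U
    simp only [MeasuredSystem.prob, hs, hp, localProver_onTape]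
    congr 1
    · exact finsuppWt_onTape U _
    · have := ih (j + 1) (V.boundedOp (U (0 + j)).1 *ᵥ
        V.boundedSystem.proj StateKind.non (V.boundedSystem.step σ φ))
      simpa only [add_assoc, add_comm 1 j] using this

theorem onTape_boundedStart : onTape U V.boundedStart = V.localStart (V.boundedProver U) := by
  rw [boundedStart, onTape, Fintype.linearCombination_apply_single, one_smul, localStart,
    memoryTape_blank]

theorem pAcc_boundedProver (hV : V.IsOneWay) (x : List α) :
    V.pAcc (V.boundedProver U) x = V.boundedSystem.prob StateKind.acc (inputTape x)
      (fun i φ => V.boundedOp (U i).1 *ᵥ φ) V.boundedStart := by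
  rw [pAcc, tsum_probAt hV, ← onTape_boundedStart]
  exact prob_onTape U _ x _ 0 _

end QfaVerifier

theorem QIP1qfa_subset_REG (α : Type*) : QIP1qfa α ⊆ REG α := by
  intro L hL
  simp only [QIP1qfa, Set.mem_iUnion] at hL
  obtain ⟨ε, ⟨hε, -⟩, V, hwf, hV, ⟨P, hP⟩, hsound⟩ := hL
  have hU := (QfaVerifier.wellFormed_iff hV.1).1 hwf
  refine isRegular_of_vecSystem (B := V.boundedStep) (kind := fun c => V.kind c.1)
    (𝒞 := V.boundedOps) (φ := V.boundedStart) (lo := 1 / 2 - ε) (hi := 1 / 2 + ε)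
    (fun σ => QfaVerifier.boundedStep_mem_unitaryGroup (hU σ))
    QfaVerifier.boundedOps_subset_unitaryGroup ⟨_, 1, one_mem _, rfl⟩ ?_ (by linarith) ?_ ?_
  · rw [Finset.sum_eq_single (V.start, V.blank, (V.start, V.blank))]
    · simp [QfaVerifier.boundedStart]
    · intro c _ hc
      simp [QfaVerifier.boundedStart, hc]
    · simp
  · intro x hx
    obtain ⟨C, hC, h⟩ := QfaVerifier.exists_bounded_strategy (P := P) x (inputTape x) 0
      QfaVerifier.sameGram_start
    exact ⟨C, hC, (hP x hx).trans_eq ((QfaVerifier.tsum_probAt hV _ x).trans h)⟩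
  -- Soundness against all provers applies to the one carrying out the given bounded strategy.
  · intro x hx C hC
    choose U hUmem hUC using hC
    have h1 := hsound x hx (V.boundedProver fun i => ⟨U i, hUmem i⟩)
    have h2 := QfaVerifier.pAcc_add_pRej (P := V.boundedProver fun i => ⟨U i, hUmem i⟩) hwf hV x
    rw [QfaVerifier.pAcc_boundedProver _ hV] at h2
    simp only [hUC] at h2
    exact le_of_add_le_add_right (h2.le.trans (by linarith) : _ ≤ (1 / 2 - ε) + V.pRej _ x)

/-! ### Verifying a deterministic automaton -/

instance : Fintype StateKind :=
  ⟨{StateKind.non, StateKind.acc, StateKind.rej}, by rintro (_ | _ | _) <;> simp⟩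

theorem exists_perm_apply_eq {A X : Type*} [Fintype X] [DecidableEq X] {f g : A → X}
    (hf : Function.Injective f) (hg : Function.Injective g) :
    ∃ π : Equiv.Perm X, ∀ a, π (f a) = g a := by
  classical
  let e : {x // x ∈ Set.range f} ≃ {x // x ∈ Set.range g} :=
    (Equiv.ofInjective f hf).symm.trans (Equiv.ofInjective g hg)
  refine ⟨e.extendSubtype, fun a => ?_⟩
  rw [e.extendSubtype_apply_of_mem (f a) ⟨a, rfl⟩]
  have : (Equiv.ofInjective f hf).symm ⟨f a, a, rfl⟩ = a :=
    (Equiv.ofInjective f hf).symm_apply_apply a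
  simp only [e, Equiv.trans_apply, this]
  rfl

/-- The matrix that maps the basis vector at `v` to the basis vector at `π v`. -/
def basisPerm {X : Type*} [DecidableEq X] (π : Equiv.Perm X) : Matrix X X ℂ :=
  fun v' v => if v' = π v then 1 else 0

theorem basisPerm_mem_unitaryGroup {X : Type*} [Fintype X] [DecidableEq X] (π : Equiv.Perm X) :
    basisPerm π ∈ Matrix.unitaryGroup X ℂ := by
  rw [Matrix.mem_unitaryGroup_iff']
  ext u v
  simp [Matrix.mul_apply, Matrix.star_apply, basisPerm, Matrix.one_apply, eq_comm]

/-- Soundness and completeness below are perfect, so tracking which configurations can have nonzero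
amplitude replaces all estimates. -/
theorem linearCombination_sum_single_mem_supported {X Y W : Type*} [Fintype W] {g : X → W → Y}
    {a : X → W → ℂ} {A : Set X} {B : Set Y} (h : ∀ c ∈ A, ∀ w, a c w ≠ 0 → g c w ∈ B)
    {ψ : X →₀ ℂ} (hψ : ψ ∈ Finsupp.supported ℂ ℂ A) :
    Finsupp.linearCombination ℂ (fun c => ∑ w, Finsupp.single (g c w) (a c w)) ψ ∈
      Finsupp.supported ℂ ℂ B := by
  rw [Finsupp.linearCombination_apply, Finsupp.sum]
  refine Submodule.sum_mem _ fun c hc => Submodule.smul_mem _ _ (Submodule.sum_mem _ fun w _ => ?_)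
  by_cases hw : a c w = 0
  · rw [hw, Finsupp.single_zero]
    exact Submodule.zero_mem _
  · exact Finsupp.single_mem_supported ℂ _ (h c (hψ hc) w hw)

/-! ### The verifier for a deterministic automaton and its soundness -/

namespace DFA

variable {α : Type*} {S : Type}

/-- The step of the automaton on a tape symbol; endmarkers do not change the state. -/
def tapeStep (M : DFA α S) : TapeSymbol α → S → S
  | TapeSymbol.left, s => s
  | TapeSymbol.letter a, s => M.step s a
  | TapeSymbol.right, s => s

open Classical in
/-- The verifier's reaction to a tape symbol in the non-halting state `s` with communication symbol
`γ`: if the cell is blank, he simulates the automaton and hands the old state over to the prover;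
otherwise he rejects. -/
noncomputable def verifierStep (M : DFA α S) :
    TapeSymbol α → S × Option S → (S × StateKind) × Option S
  | TapeSymbol.right, (s, none) =>
      ((s, if s ∈ M.accept then StateKind.acc else StateKind.rej), none)
  | σ, (s, none) => ((M.tapeStep σ s, StateKind.non), some s)
  | _, (s, some r) => ((s, StateKind.rej), some r)

/-- The old state is always recoverable: it is kept as inner state or written into the communication
cell. The blank and nonblank cases are told apart by the kind of the new state or, at the right
endmarker, by the new communication symbol. -/
theorem verifierStep_injective (M : DFA α S) (σ : TapeSymbol α) :
    Function.Injective (M.verifierStep σ) := by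
  rintro ⟨s, _ | r⟩ ⟨s', _ | r'⟩ h <;> cases σ <;> simp_all [verifierStep]

theorem foldl_tapeStep (M : DFA α S) (x : List α) :
    (TapeSymbol.left :: x.map TapeSymbol.letter).foldl (fun s σ => M.tapeStep σ s) M.start =
      M.eval x := by
  simp [List.foldl_map, tapeStep, eval, evalFrom]

variable (S) in
theorem nonHalting_injective :
    Function.Injective fun p : S × Option S => ((p.1, StateKind.non), p.2) := by
  rintro ⟨s, r⟩ ⟨s', r'⟩ h
  simpa using h

variable [Fintype S] [DecidableEq S] (M : DFA α S)

/-- A permutation that extends `verifierStep`. -/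
noncomputable def verifierPerm (σ : TapeSymbol α) : Equiv.Perm ((S × StateKind) × Option S) :=
  (exists_perm_apply_eq (nonHalting_injective S) (M.verifierStep_injective σ)).choose

theorem verifierPerm_apply (σ : TapeSymbol α) (s : S) (γ : Option S) :
    M.verifierPerm σ ((s, StateKind.non), γ) = M.verifierStep σ (s, γ) :=
  (exists_perm_apply_eq (nonHalting_injective S) (M.verifierStep_injective σ)).choose_spec (s, γ)

/-- The verifier that simulates the automaton reversibly with the help of the prover. -/
noncomputable abbrev verifier : QfaVerifier α where
  Q := S × StateKind
  Γ := Option S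
  kind := Prod.snd
  start := (M.start, StateKind.non)
  kind_start := rfl
  blank := none
  δ q σ γ q' γ' d := if d = 1 then basisPerm (M.verifierPerm σ) (q', γ') (q, γ) else 0

theorem verifier_trans (σ : TapeSymbol α) :
    M.verifier.trans σ = basisPerm (M.verifierPerm σ) := by
  ext v' v
  simp [QfaVerifier.trans]

theorem verifier_movesRight : M.verifier.MovesRight := by
  intro q σ γ q' γ' d hd
  simp [hd]

theorem verifier_wellFormed : M.verifier.WellFormed := by
  rw [QfaVerifier.wellFormed_iff M.verifier_movesRight]
  intro σ
  rw [verifier_trans]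
  exact basisPerm_mem_unitaryGroup _

variable {M} {P : Prover α M.verifier.Γ}

/-- Configurations without the head position. -/
abbrev LocalConfig (P : Prover α M.verifier.Γ) : Type :=
  (S × StateKind) × Option S × PrivateTape P.Δ P.blank

/-- Restricted to non-halting configurations, since `verifierPerm` is an arbitrary extension
elsewhere. -/
theorem localMove_mem_supported {A B : Set (LocalConfig P)} {σ : TapeSymbol α}
    (hA : ∀ c ∈ A, c.1.2 = StateKind.non)
    (h : ∀ c ∈ A, ((M.verifierStep σ (c.1.1, c.2.1)).1,
      (M.verifierStep σ (c.1.1, c.2.1)).2, c.2.2) ∈ B)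
    {ψ : M.verifier.Local P} (hψ : ψ ∈ Finsupp.supported ℂ ℂ A) :
    M.verifier.localMove P σ ψ ∈ Finsupp.supported ℂ ℂ B := by
  refine linearCombination_sum_single_mem_supported (A := A) (B := B) ?_ hψ
  rintro ⟨⟨s, κ⟩, γ, y⟩ hc w hw
  obtain rfl : κ = StateKind.non := hA _ hc
  rw [verifier_trans] at hw
  have hw' : w = M.verifierPerm σ ((s, StateKind.non), γ) := by
    by_contra hne
    exact hw (if_neg hne)
  rw [verifierPerm_apply] at hw'
  subst hw'
  exact h _ hc

theorem localProj_mem_supported {A B : Set (LocalConfig P)} {κ : StateKind}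
    (h : ∀ c ∈ A, c.1.2 = κ → c ∈ B) {ψ : M.verifier.Local P}
    (hψ : ψ ∈ Finsupp.supported ℂ ℂ A) :
    M.verifier.localProj P κ ψ ∈ Finsupp.supported ℂ ℂ B := by
  rw [Finsupp.mem_supported'] at hψ ⊢
  intro c hc
  rw [QfaVerifier.localProj_apply]
  split_ifs with hκ
  · exact hψ c fun hcA => hc (h c hcA hκ)
  · rfl

theorem localProj_eq_zero {A : Set (LocalConfig P)} {κ : StateKind}
    (h : ∀ c ∈ A, c.1.2 ≠ κ) {ψ : M.verifier.Local P} (hψ : ψ ∈ Finsupp.supported ℂ ℂ A) :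
    M.verifier.localProj P κ ψ = 0 := by
  have := localProj_mem_supported (B := ∅) (fun c hc hκ => (h c hc hκ).elim) hψ
  rwa [Finsupp.supported_empty, Submodule.mem_bot] at this

/-- The non-halting configurations with automaton state `s`. -/
def simulating (P : Prover α M.verifier.Γ) (s : S) : Set (LocalConfig P) :=
  {c | c.1 = (s, StateKind.non)}

/-- `simulating` constrains neither communication cell nor private tape, so no prover can leave it.
-/
theorem localProver_mem_supported_simulating (x : List α) (i : ℕ) {s : S}
    {ψ : M.verifier.Local P} (hψ : ψ ∈ Finsupp.supported ℂ ℂ (simulating P s)) :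
    M.verifier.localProver P x i ψ ∈ Finsupp.supported ℂ ℂ (simulating P s) := by
  have h : ∀ c ∈ simulating P s, ∀ w : Option S × (Fin (P.cells x i) → P.Δ),
      (P.op x i).1 w (c.2.1, c.2.2.initial (P.cells x i)) ≠ 0 →
      (c.1, w.1, c.2.2.overwrite w.2) ∈ simulating P s := fun _ hc _ _ => hc
  rw [QfaVerifier.localProver]
  exact linearCombination_sum_single_mem_supported h hψ

theorem localMove_mem_supported_simulating {σ : TapeSymbol α} (hσ : σ ≠ TapeSymbol.right) {s : S}
    {ψ : M.verifier.Local P} (hψ : ψ ∈ Finsupp.supported ℂ ℂ (simulating P s)) :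
    M.verifier.localMove P σ ψ ∈ Finsupp.supported ℂ ℂ
      {c : LocalConfig P | c.1 = (M.tapeStep σ s, StateKind.non) ∨ c.1.2 = StateKind.rej} := by
  refine localMove_mem_supported (A := simulating P s) (fun c hc => by rw [hc]) ?_ hψ
  rintro ⟨_, γ, y⟩ rfl
  cases γ <;> cases σ <;> simp_all [verifierStep]

theorem localProj_non_mem_supported_simulating {σ : TapeSymbol α} (hσ : σ ≠ TapeSymbol.right)
    {s : S} {ψ : M.verifier.Local P} (hψ : ψ ∈ Finsupp.supported ℂ ℂ (simulating P s)) :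
    M.verifier.localProj P StateKind.non (M.verifier.localMove P σ ψ) ∈
      Finsupp.supported ℂ ℂ (simulating P (M.tapeStep σ s)) := by
  refine localProj_mem_supported ?_ (localMove_mem_supported_simulating hσ hψ)
  rintro ⟨⟨r, κ⟩, γ, y⟩ (h | h) h'
  · exact h
  · simp_all

theorem localProj_acc_eq_zero {σ : TapeSymbol α} (hσ : σ ≠ TapeSymbol.right)
    {s : S} {ψ : M.verifier.Local P} (hψ : ψ ∈ Finsupp.supported ℂ ℂ (simulating P s)) :
    M.verifier.localProj P StateKind.acc (M.verifier.localMove P σ ψ) = 0 := by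
  refine localProj_eq_zero ?_ (localMove_mem_supported_simulating hσ hψ)
  rintro ⟨⟨r, κ⟩, γ, y⟩ (h | h) h' <;> simp_all

theorem localProj_non_right_eq_zero {s : S} {ψ : M.verifier.Local P}
    (hψ : ψ ∈ Finsupp.supported ℂ ℂ (simulating P s)) :
    M.verifier.localProj P StateKind.non (M.verifier.localMove P TapeSymbol.right ψ) = 0 := by
  refine localProj_eq_zero (A := {c : LocalConfig P | c.1.2 ≠ StateKind.non}) (fun _ hc => hc)
    (localMove_mem_supported (A := simulating P s) (fun c hc => by rw [hc]) ?_ hψ)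
  rintro ⟨_, γ, y⟩ rfl
  cases γ
  · by_cases hs : s ∈ M.accept <;> simp [verifierStep, hs]
  · simp [verifierStep]

theorem localProj_acc_right_eq_zero {s : S} (hs : s ∉ M.accept) {ψ : M.verifier.Local P}
    (hψ : ψ ∈ Finsupp.supported ℂ ℂ (simulating P s)) :
    M.verifier.localProj P StateKind.acc (M.verifier.localMove P TapeSymbol.right ψ) = 0 := by
  refine localProj_eq_zero (A := {c : LocalConfig P | c.1.2 ≠ StateKind.acc}) (fun _ hc => hc)
    (localMove_mem_supported (A := simulating P s) (fun c hc => by rw [hc]) ?_ hψ)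
  rintro ⟨_, γ, y⟩ rfl
  cases γ <;> simp [verifierStep, hs]

theorem finsuppWt_zero {X : Type*} : finsuppWt (0 : X →₀ ℂ) = 0 := by
  simp [finsuppWt]

theorem run_mem_supported_simulating (x : List α) (u : List (TapeSymbol α))
    (hu : TapeSymbol.right ∉ u) (f : ℕ → ℕ) {s : S} {ψ : M.verifier.Local P}
    (hψ : ψ ∈ Finsupp.supported ℂ ℂ (simulating P s)) :
    (M.verifier.localSystem P).run u (fun i => M.verifier.localProver P x (f i)) ψ ∈
      Finsupp.supported ℂ ℂ (simulating P (u.foldl (fun s σ => M.tapeStep σ s) s)) := by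
  induction u generalizing f s ψ with
  | nil => exact hψ
  | cons σ u ih =>
    rw [List.mem_cons, not_or] at hu
    exact ih hu.2 (fun i => f (i + 1)) (localProver_mem_supported_simulating x (f 0)
      (localProj_non_mem_supported_simulating (Ne.symm hu.1) hψ))

/-- Whatever the prover does, the surviving part carries the true automaton state; a nonblank reply
merely causes rejection. Acceptance happens only at the right endmarker, by the correct final state.
The reindexing `f` absorbs the shift of rounds in the induction. -/
theorem prob_acc_eq_zero (x : List α) (u : List (TapeSymbol α))
    (hu : TapeSymbol.right ∉ u) (f : ℕ → ℕ) {s : S} {ψ : M.verifier.Local P}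
    (hs : u.foldl (fun s σ => M.tapeStep σ s) s ∉ M.accept)
    (hψ : ψ ∈ Finsupp.supported ℂ ℂ (simulating P s)) :
    (M.verifier.localSystem P).prob StateKind.acc (u ++ [TapeSymbol.right])
      (fun i => M.verifier.localProver P x (f i)) ψ = 0 := by
  induction u generalizing f s ψ with
  | nil =>
    have h := localProj_acc_right_eq_zero hs hψ
    simp [MeasuredSystem.prob, QfaVerifier.localSystem, h, finsuppWt_zero]
  | cons σ u ih =>
    rw [List.mem_cons, not_or] at hu
    have h1 := ih hu.2 (fun i => f (i + 1)) hs (localProver_mem_supported_simulating x (f 0)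
      (localProj_non_mem_supported_simulating (Ne.symm hu.1) hψ))
    have h2 := localProj_acc_eq_zero (Ne.symm hu.1) hψ
    rw [List.cons_append, MeasuredSystem.prob]
    have h3 : (M.verifier.localSystem P).wt ((M.verifier.localSystem P).proj StateKind.acc
        ((M.verifier.localSystem P).step σ ψ)) = 0 := by
      change finsuppWt (M.verifier.localProj P StateKind.acc (M.verifier.localMove P σ ψ)) = 0
      rw [h2, finsuppWt_zero]
    rw [h3, zero_add]
    exact h1

theorem localStart_mem_supported : M.verifier.localStart P ∈
    Finsupp.supported ℂ ℂ (simulating P M.start) :=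
  Finsupp.single_mem_supported ℂ _ rfl

theorem right_notMem_letters (x : List α) :
    TapeSymbol.right ∉ TapeSymbol.left :: x.map TapeSymbol.letter := by
  simp

variable (M) in
theorem verifier_isOneWay : M.verifier.IsOneWay := by
  refine ⟨M.verifier_movesRight, fun P x => ?_⟩
  have hpre : TapeSymbol.left :: x.map TapeSymbol.letter <+: inputTape x :=
    ⟨[TapeSymbol.right], by simp [inputTape]⟩
  have h1 := (QfaVerifier.sum_probAt_eq (P := P) M.verifier_movesRight StateKind.non x hpre).2
  have h2 := run_mem_supported_simulating x _ (right_notMem_letters x) id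
    (localStart_mem_supported (P := P))
  have hlen : (TapeSymbol.left :: x.map (TapeSymbol.letter (α := α))).length = x.length + 1 := by
    simp
  rw [hlen] at h1
  rw [QfaVerifier.outcome_atCell M.verifier_movesRight StateKind.non x
    (by rw [length_inputTape]; omega) h1]
  have h3 : (inputTape x)[x.length + 1]'(by rw [length_inputTape]; omega) = TapeSymbol.right := by
    simp [inputTape]
  rw [h3]
  -- At the right endmarker every branch of `verifierStep` halts.
  exact (congrArg _ (localProj_non_right_eq_zero h2)).trans (map_zero _)

theorem verifier_sound {x : List α} (hx : x ∉ M.accepts) : 1 ≤ M.verifier.pRej P x := by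
  have h := QfaVerifier.pAcc_add_pRej (P := P) M.verifier_wellFormed M.verifier_isOneWay x
  have h0 : M.verifier.pAcc P x = 0 := by
    rw [QfaVerifier.pAcc, QfaVerifier.tsum_probAt M.verifier_isOneWay]
    have := prob_acc_eq_zero x _ (right_notMem_letters x) id (s := M.start)
      (by rw [foldl_tapeStep]; exact hx) (localStart_mem_supported (P := P))
    simpa [inputTape] using this
  linarith

end DFA

/-! ### The honest prover and perfect completeness -/

namespace DFA

variable {α : Type*} {S : Type}

/-- Exchange a communication symbol with the content of the last of `i + 1` tape cells. -/
def swapLast (Γ : Type) (i : ℕ) : Equiv.Perm (Γ × (Fin (i + 1) → Γ)) where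
  toFun p := (p.2 (Fin.last i), Function.update p.2 (Fin.last i) p.1)
  invFun p := (p.2 (Fin.last i), Function.update p.2 (Fin.last i) p.1)
  left_inv p := by simp
  right_inv p := by simp

variable [Fintype S] [DecidableEq S]

variable (S) in
/-- The prover who stores the `i`-th message in the `i`-th cell of his tape and returns a blank. -/
noncomputable abbrev honestProver (α : Type*) : Prover α (Option S) where
  Δ := Option S
  blank := none
  cells _ i := i + 1
  op _ i := ⟨basisPerm (swapLast (Option S) i), basisPerm_mem_unitaryGroup _⟩

variable {M : DFA α S}

/-- The honest prover's configurations with automaton state `s` before his operation on cell `t`. -/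
def handed (M : DFA α S) (t : ℕ) (s : S) :
    Set (LocalConfig (M := M) (honestProver S α)) :=
  {c | c.1 = (s, StateKind.non) ∧ ∀ i, t ≤ i → c.2.2.1 i = none}

/-- The honest prover's configurations with automaton state `s` and blank communication cell. -/
def awaiting (M : DFA α S) (t : ℕ) (s : S) :
    Set (LocalConfig (M := M) (honestProver S α)) :=
  {c | c ∈ M.handed t s ∧ c.2.1 = none}

/-- Cell `t` is still blank in round `t`, so the swap puts a blank into the communication cell and
leaves all later cells blank. -/
theorem localProver_mem_supported_awaiting (x : List α) (t : ℕ) (s : S)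
    {ψ : M.verifier.Local (honestProver S α)} (hψ : ψ ∈ Finsupp.supported ℂ ℂ (M.handed t s)) :
    M.verifier.localProver (honestProver S α) x t ψ ∈
      Finsupp.supported ℂ ℂ (M.awaiting (t + 1) s) := by
  have h : ∀ c ∈ M.handed t s, ∀ w : Option S × (Fin (t + 1) → Option S),
      basisPerm (swapLast (Option S) t) w (c.2.1, c.2.2.initial (t + 1)) ≠ 0 →
      (c.1, w.1, c.2.2.overwrite w.2) ∈ M.awaiting (t + 1) s := by
    rintro ⟨q, γ, y⟩ ⟨hq, hy⟩ w hw
    have hw' : w = swapLast (Option S) t (γ, y.initial (t + 1)) := by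
      by_contra hne
      exact hw (if_neg hne)
    subst hw'
    refine ⟨⟨hq, fun i hi => ?_⟩, hy t le_rfl⟩
    have hlt : ¬ i < t + 1 := by omega
    simp only [PrivateTape.overwrite, dif_neg hlt]
    exact hy i (by omega)
  rw [QfaVerifier.localProver]
  exact linearCombination_sum_single_mem_supported h hψ

theorem localMove_mem_supported_handed {σ : TapeSymbol α} (hσ : σ ≠ TapeSymbol.right) {t : ℕ}
    {s : S} {ψ : M.verifier.Local (honestProver S α)}
    (hψ : ψ ∈ Finsupp.supported ℂ ℂ (M.awaiting t s)) :
    M.verifier.localMove (honestProver S α) σ ψ ∈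
      Finsupp.supported ℂ ℂ (M.handed t (M.tapeStep σ s)) := by
  refine localMove_mem_supported (A := M.awaiting t s) (fun c hc => by rw [hc.1.1]) ?_ hψ
  rintro ⟨q, γ, y⟩ ⟨⟨hq, hy⟩, hγ⟩
  simp only at hq hy hγ
  subst hq hγ
  cases σ
  · exact ⟨rfl, hy⟩
  · exact ⟨rfl, hy⟩
  · exact absurd rfl hσ

theorem localProj_rej_right_eq_zero {t : ℕ} {s : S} (hs : s ∈ M.accept)
    {ψ : M.verifier.Local (honestProver S α)}
    (hψ : ψ ∈ Finsupp.supported ℂ ℂ (M.awaiting t s)) :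
    M.verifier.localProj (honestProver S α) StateKind.rej
      (M.verifier.localMove (honestProver S α) TapeSymbol.right ψ) = 0 := by
  refine localProj_eq_zero (A := {c | c.1.2 ≠ StateKind.rej}) (fun _ hc => hc)
    (localMove_mem_supported (A := M.awaiting t s) (fun c hc => by rw [hc.1.1]) ?_ hψ)
  rintro ⟨q, γ, y⟩ ⟨⟨hq, hy⟩, hγ⟩
  simp only at hq hy hγ
  subst hq hγ
  simp [verifierStep, hs]

/-- The verifier always finds a blank cell, so the rejecting branch for nonblank replies never
occurs. The hypothesis on `f` keeps the round number equal to the number of tape cells already used.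
-/
theorem prob_rej_eq_zero (x : List α) (u : List (TapeSymbol α))
    (hu : TapeSymbol.right ∉ u) {t : ℕ} {f : ℕ → ℕ} (hf : ∀ i, f i = t + i) {s : S}
    (hs : u.foldl (fun s σ => M.tapeStep σ s) s ∈ M.accept)
    {ψ : M.verifier.Local (honestProver S α)}
    (hψ : ψ ∈ Finsupp.supported ℂ ℂ (M.awaiting t s)) :
    (M.verifier.localSystem (honestProver S α)).prob StateKind.rej (u ++ [TapeSymbol.right])
      (fun i => M.verifier.localProver (honestProver S α) x (f i)) ψ = 0 := by
  induction u generalizing t f s ψ with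
  | nil =>
    have h := localProj_rej_right_eq_zero hs hψ
    simp [MeasuredSystem.prob, QfaVerifier.localSystem, h, finsuppWt_zero]
  | cons σ u ih =>
    rw [List.mem_cons, not_or] at hu
    have h1 := localMove_mem_supported_handed (Ne.symm hu.1) hψ
    have h2 : (M.verifier.localSystem (honestProver S α)).wt
        ((M.verifier.localSystem (honestProver S α)).proj StateKind.rej
          ((M.verifier.localSystem (honestProver S α)).step σ ψ)) = 0 := by
      have h3 : M.verifier.localProj (honestProver S α) StateKind.rej
          (M.verifier.localMove (honestProver S α) σ ψ) = 0 :=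
        localProj_eq_zero (fun c hc => by rw [hc.1]; simp) h1
      exact (congrArg finsuppWt h3).trans finsuppWt_zero
    have h4 := localProver_mem_supported_awaiting x t _
      (localProj_mem_supported (κ := StateKind.non) (fun c hc _ => hc) h1)
    obtain rfl : f 0 = t := hf 0
    rw [List.cons_append, MeasuredSystem.prob, h2, zero_add]
    exact ih hu.2 (f := fun i => f (i + 1)) (fun i => by rw [hf (i + 1)]; ring) hs h4

theorem verifier_complete {x : List α} (hx : x ∈ M.accepts) :
    1 ≤ M.verifier.pAcc (honestProver S α) x := by
  have h := QfaVerifier.pAcc_add_pRej (P := honestProver S α) M.verifier_wellFormed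
    M.verifier_isOneWay x
  have h0 : M.verifier.pRej (honestProver S α) x = 0 := by
    rw [QfaVerifier.pRej, QfaVerifier.tsum_probAt M.verifier_isOneWay]
    have := prob_rej_eq_zero (M := M) x _ (right_notMem_letters x) (t := 0) (f := id) (by simp)
      (s := M.start) (by rw [foldl_tapeStep]; exact hx)
      (ψ := M.verifier.localStart (honestProver S α))
      (Finsupp.single_mem_supported ℂ _ ⟨⟨rfl, fun _ _ => rfl⟩, rfl⟩)
    simpa [inputTape] using this
  linarith

end DFA

theorem REG_subset_QIPab1qfa_one_one (α : Type*) : REG α ⊆ QIPab1qfa 1 1 α := by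
  rintro L ⟨S, _, M, rfl⟩
  classical
  exact ⟨M.verifier, M.verifier_wellFormed, M.verifier_isOneWay,
    ⟨DFA.honestProver S α, fun x hx => DFA.verifier_complete hx⟩,
    fun x hx P => DFA.verifier_sound hx⟩

theorem QIPab1qfa_one_one_subset_QIP1qfa (α : Type*) : QIPab1qfa 1 1 α ⊆ QIP1qfa α := by
  intro L hL
  -- The largest admissible `ε`, for which `1 / 2 + ε = 1`.
  refine Set.mem_biUnion (x := (1 / 2 : ℝ)) ⟨by norm_num, le_rfl⟩ ?_
  norm_num
  exact hL

theorem theorem1 (α : Type*) [Fintype α] :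
    QIP1qfa α = REG α ∧
    REG α ⊆ QIPab1qfa 1 1 α ∧
    Class1QFA α ⊆ QIP1qfa α ∧
    (Nontrivial α → Class1QFA α ⊂ QIP1qfa α) := by
  have hREG := REG_subset_QIPab1qfa_one_one α
  have hQIP := hREG.trans (QIPab1qfa_one_one_subset_QIP1qfa α)
  have hsub := (class1QFA_subset_REG α).trans hQIP
  refine ⟨(QIP1qfa_subset_REG α).antisymm hQIP, hREG, hsub, fun _ => ⟨hsub, fun h => ?_⟩⟩
  classical
  obtain ⟨a, b, hab⟩ := exists_pair_ne α
  exact lastLetterDFA_accepts_notMem_class1QFA hab.symm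
    (h (hQIP (lastLetterDFA_accepts_mem_REG a)))
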